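/- Let $\mathcal G=(\mathcal V,\mathcal E)$ be a finite, directed, connected graph without loops, whose edges $e=(v^{in},v^{out})$ have lengths $\ell_e>0$ and are identified with intervals $(0,\ell_e)$; set $n_e(v^{in})=-1$, $n_e(v^{out})=1$ and $n_e(v)=0$ otherwise. Let $\mathcal E(v)$ be the set of edges incident to $v$, $\mathcal V_\partial=\{v:|\mathcal E(v)|=1\}$, $\mathcal V_0=\mathcal V\setminus\mathcal V_\partial$, and let $\mathcal V_\partial^{in}$ be the set of those $v\in\mathcal V_\partial$ with $n_e(v)=-1$ for $e\in\mathcal E(v)$. Fix an integer $k\ge1$, $\alpha>0$, $t_{max}>0$ and $0<\underline b\le\bar b$. Then there is a constant $C$, depending only on $k,\alpha,t_{max},\underline b,\bar b$, with the following property. Let $0<\varepsilon\le1$, let $\underline b\le b_e\le\bar b$ for all $e$ with $\sum_{e\in\mathcal E(v)}b_en_e(v)=0$ for $v\in\mathcal V_0$, and let $\hat g\in C^{m+2}([0,t_{max}];\ell^2(\mathcal V_\partial))$ with $\partial_t^j\hat g(0)=0$ for $0\le j\le m$, for some $m\ge0$. Let $(u^\varepsilon,\hat u^\varepsilon)$,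 with $u^\varepsilon\in C^1([0,t_{max}];L^2(\mathcal E))\cap C^0([0,t_{max}];H^2_{pw}(\mathcal E))$ and $u^\varepsilon(0)=0$, be the solution of $$\partial_tu^\varepsilon_e+b_e\partial_xu^\varepsilon_e=\varepsilon\,\partial_{xx}u^\varepsilon_e \ \text{ on every edge},\qquad u^\varepsilon(v,t)=\hat g_v(t)\ (v\in\mathcal V_\partial),$$ $$u^\varepsilon_e(v,t)=\hat u^\varepsilon_v(t)\ (v\in\mathcal V_0,\ e\in\mathcal E(v)),\qquad \sum_{e\in\mathcal E(v)}\big(b_eu^\varepsilon_e(v,t)-\varepsilon\,\partial_xu^\varepsilon_e(v,t)\big)n_e(v)=0\ (v\in\mathcal V_0)$$ for $0<t<t_{max}$. Let $\mathcal T_h$ be any mesh that splits each edge into intervals $T$ of length $h_T$ with mesh points $0=x_e^0<\dots<x_e^{M_e}=\ell_e$, and let $\mathcal X_h$ be the set of mesh points in the interior of the edges. Let $W_h$ be the space of functions on the network that are polynomials of degree $\le k$ on each $T$, and $\hat W_h$ the space of functions on $\mathcal V\cup\mathcal X_h$ that vanish on $\mathcal V_\partial$. Write $(\cdot,\cdot)_{\mathcal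 T_h}$ for the $L^2$ scalar product, $\langle\cdot,\cdot\rangle_{\partial\mathcal T_h}$ for the sum over both end points of all elements (values of functions in $W_h$ taken from inside the element), $\langle\cdot,\cdot\rangle_{\mathcal V_\partial}$ and $\langle\cdot,\cdot\rangle_{\mathcal V_\partial^{in}}$ for its restrictions to the end points in $\mathcal V_\partial$ and $\mathcal V_\partial^{in}$, $n=\mp1$ at the left/right end point of an element, and $h_{loc}|_T=h_T$. Let $u_h^\varepsilon\in C^1([0,t_{max}];W_h)$ with $u_h^\varepsilon(0)=0$ and $\hat u_h^\varepsilon\in C^0([0,t_{max}];\hat W_h)$ satisfy, for all $0\le t\le t_{max}$, $w\in W_h$, $\hat w\in\hat W_h$, $$(\partial_tu_h^\varepsilon,w)_{\mathcal T_h}+b_h(u_h^\varepsilon,\hat u_h^\varepsilon;w,\hat w)+\varepsilon\, d_h(u_h^\varepsilon,\hat u_h^\varepsilon;w,\hat w)=\ell_h(t;w),$$ where $$b_h(u,\hat u;w,\hat w)=-(bu,\partial_xw)_{\mathcal T_h}+\langle \max(nb,0)u+\min(nb,0)\hat u,\,w-\hat w\rangle_{\partial\mathcal T_h},$$ $$d_h(u,\hat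 u;w,\hat w)=(\partial_xu,\partial_xw)_{\mathcal T_h}-\langle n\partial_xu,w-\hat w\rangle_{\partial\mathcal T_h}+\langle n(u-\hat u),\partial_xw\rangle_{\partial\mathcal T_h}+\langle\tfrac{\alpha}{h_{loc}}(u-\hat u),w-\hat w\rangle_{\partial\mathcal T_h},$$ $$\ell_h(t;w)=-\langle nb\,\hat g(t),w\rangle_{\mathcal V_\partial^{in}}+\langle n\varepsilon\,\hat g(t),\partial_xw\rangle_{\mathcal V_\partial}+\langle\tfrac{\alpha\varepsilon}{h_{loc}}\hat g(t),w\rangle_{\mathcal V_\partial}.$$ Then for all $0<t<t_{max}$ $$\|u^\varepsilon(t)-u_h^\varepsilon(t)\|^2_{L^2(\mathcal E)}\le C\sum_{T\in\mathcal T_h}\big(\varepsilon h_T^{2k}+h_T^{2k+2}\big)\,\|u^\varepsilon\|^2_{H^1(0,t_{max};H^{k+1}(T))},$$ where the right-hand side is $+\infty$ if $u^\varepsilon|_T\notin H^1(0,t_{max};H^{k+1}(T))$ for some $T$. -/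

import Mathlib

open MeasureTheory Set
open scoped ContDiff ENNReal Polynomial

noncomputable section

namespace HybridDG

/-! ### Sobolev spaces on intervals -/

/-- `L²(a, b; X)`. -/
abbrev L2 (a b : ℝ) (X : Type*) [NormedAddCommGroup X] : Type _ :=
  Lp X 2 (volume.restrict (Ioo a b))

/-- Test functions: smooth real functions with compact support in `(a, b)`. -/
def IsTest (a b : ℝ) (φ : ℝ → ℝ) : Prop :=
  ContDiff ℝ ∞ φ ∧ HasCompactSupport φ ∧ tsupport φ ⊆ Ioo a b

/-- `g` is the `i`-th weak derivative on `(a, b)` of `f`. -/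
def IsWeakDeriv {a b : ℝ} {X : Type*} [NormedAddCommGroup X] [NormedSpace ℝ X]
    (i : ℕ) (f g : L2 a b X) : Prop :=
  ∀ φ : ℝ → ℝ, IsTest a b φ →
    ∫ x in Ioo a b, iteratedDeriv i φ x • f x = (-1 : ℝ) ^ i • ∫ x in Ioo a b, φ x • g x

theorem IsTest.memLp {a b : ℝ} {φ : ℝ → ℝ} (h : IsTest a b φ) (i : ℕ) :
    MemLp (iteratedDeriv i φ) 2 (volume.restrict (Ioo a b)) := by
  have hc : Continuous (iteratedDeriv i φ) :=
    h.1.continuous_iteratedDeriv i (by exact_mod_cast le_top)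
  have hs : HasCompactSupport (iteratedDeriv i φ) := by
    have h2 : HasCompactSupport (iteratedFDeriv ℝ i φ) := h.2.1.iteratedFDeriv i
    refine h2.mono ?_
    intro x hx hx'
    apply hx
    simp [iteratedDeriv, hx']
  exact (hc.memLp_of_hasCompactSupport hs).restrict _

/-- The continuous functional `f ↦ ∫ φ⁽ⁱ⁾ f` on `L²`. -/
def pairing {a b : ℝ} {X : Type*} [NormedAddCommGroup X] [NormedSpace ℝ X] [CompleteSpace X]
    {φ : ℝ → ℝ} (h : IsTest a b φ) (i : ℕ) : L2 a b X →L[ℝ] X :=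
  ContinuousLinearMap.lpPairing (volume.restrict (Ioo a b)) 2 2
    (ContinuousLinearMap.lsmul ℝ ℝ) ((h.memLp i).toLp _)

theorem pairing_apply {a b : ℝ} {X : Type*} [NormedAddCommGroup X] [NormedSpace ℝ X]
    [CompleteSpace X] {φ : ℝ → ℝ} (h : IsTest a b φ) (i : ℕ) (f : L2 a b X) :
    pairing h i f = ∫ x in Ioo a b, iteratedDeriv i φ x • f x := by
  unfold pairing
  rw [ContinuousLinearMap.lpPairing_eq_integral]
  refine integral_congr_ae ?_
  filter_upwards [(h.memLp i).coeFn_toLp] with x hx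
  simp [hx]

theorem isWeakDeriv_iff {a b : ℝ} {X : Type*} [NormedAddCommGroup X] [NormedSpace ℝ X]
    [CompleteSpace X] (i : ℕ) (f g : L2 a b X) :
    IsWeakDeriv i f g ↔ ∀ (φ : ℝ → ℝ) (h : IsTest a b φ),
      pairing h i f = (-1 : ℝ) ^ i • pairing h 0 g := by
  simp only [IsWeakDeriv, pairing_apply, iteratedDeriv_zero]

/-- `Hʲ(a, b; X)`: an element is the tuple `(f, f', …, f⁽ʲ⁾)` of an `L²` function and its weak
derivatives up to order `j`; the inherited norm is `‖f‖² = ∑ i ≤ j, ‖f⁽ⁱ⁾‖²_{L²}`. -/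
def Sobolev (j : ℕ) (a b : ℝ) (X : Type*) [NormedAddCommGroup X] [NormedSpace ℝ X]
    [CompleteSpace X] : Submodule ℝ (PiLp 2 fun _ : Fin (j + 1) => L2 a b X) where
  carrier := {f | ∀ i : Fin (j + 1), IsWeakDeriv (i : ℕ) (f 0) (f i)}
  zero_mem' := by
    intro i
    rw [isWeakDeriv_iff]
    intro φ h
    simp
  add_mem' := by
    intro f g hf hg i
    have h1 := (isWeakDeriv_iff _ _ _).1 (hf i)
    have h2 := (isWeakDeriv_iff _ _ _).1 (hg i)
    rw [isWeakDeriv_iff]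
    intro φ h
    simp only [PiLp.add_apply, map_add, smul_add, h1 φ h, h2 φ h]
  smul_mem' := by
    intro c f hf i
    have h1 := (isWeakDeriv_iff _ _ _).1 (hf i)
    rw [isWeakDeriv_iff]
    intro φ h
    simp only [PiLp.smul_apply, map_smul, h1 φ h]
    rw [smul_comm]

instance (j : ℕ) (a b : ℝ) (X : Type*) [NormedAddCommGroup X] [NormedSpace ℝ X]
    [CompleteSpace X] : CompleteSpace (Sobolev j a b X) := by
  have hcl : IsClosed ((Sobolev j a b X : Submodule ℝ _) :
      Set (PiLp 2 fun _ : Fin (j + 1) => L2 a b X)) := by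
    have : ((Sobolev j a b X : Submodule ℝ _) :
        Set (PiLp 2 fun _ : Fin (j + 1) => L2 a b X)) =
        ⋂ (i : Fin (j + 1)) (φ : ℝ → ℝ) (h : IsTest a b φ),
          {f | pairing h i (f 0) = (-1 : ℝ) ^ (i : ℕ) • pairing h 0 (f i)} := by
      ext f
      simp only [mem_iInter, mem_ofPred_eq]
      exact forall_congr' fun i => isWeakDeriv_iff _ _ _
    rw [this]
    refine isClosed_iInter fun i => isClosed_iInter fun φ => isClosed_iInter fun h => ?_
    exact isClosed_eq ((pairing h i).continuous.comp (PiLp.continuous_apply 2 _ 0))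
      (((pairing h 0).continuous.comp (PiLp.continuous_apply 2 _ i)).const_smul _)
  exact hcl.completeSpace_coe

/-- The `i`-th weak derivative of an element of `Hʲ(a, b; X)`. -/
def wd {j : ℕ} {a b : ℝ} {X : Type*} [NormedAddCommGroup X] [NormedSpace ℝ X]
    [CompleteSpace X] (f : Sobolev j a b X) (i : Fin (j + 1)) : L2 a b X :=
  f.1 i

open Classical in
/-- The value at `x ∈ [a, b]` of the continuous representative of `f`
(which exists for functions in `H¹(a, b)`). -/
def ptVal {a b : ℝ} (f : L2 a b ℝ) (x : ℝ) : ℝ :=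
  if h : ∃ g : ℝ → ℝ, ContinuousOn g (Icc a b) ∧ f =ᵐ[volume.restrict (Ioo a b)] g
  then h.choose x else 0

/-- `U ∈ H¹(0, tmax; Hʲ(a, b))` is the function `t ↦ u t` restricted to `(a, b)`. -/
def Represents {tmax a b : ℝ} {j : ℕ} (U : Sobolev 1 0 tmax (Sobolev j a b ℝ))
    (u : ℝ → ℝ → ℝ) : Prop :=
  ∀ᵐ t ∂(volume.restrict (Ioo 0 tmax)), ∀ᵐ x ∂(volume.restrict (Ioo a b)),
    wd (wd U 0 t) 0 x = u t x

open Classical in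
/-- The squared norm of (the restriction to `(a, b)` of) `u` in `H¹(0, tmax; Hʲ(a, b))`,
which is `∞` if `u` does not belong to this space. -/
def bochnerNormSq (tmax : ℝ) (j : ℕ) (a b : ℝ) (u : ℝ → ℝ → ℝ) : ℝ≥0∞ :=
  if h : ∃ U : Sobolev 1 0 tmax (Sobolev j a b ℝ), Represents U u
  then ENNReal.ofReal (‖h.choose‖ ^ 2) else ⊤

/-! ### Networks -/

/-- A finite directed connected graph without loops, whose edges `e` have lengths and are
identified with the intervals `(0, len e)`. -/
structure Network (V E : Type*) where
  src : E → V
  tgt : E → V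
  src_ne_tgt : ∀ e, src e ≠ tgt e
  connected : (SimpleGraph.fromRel fun v w => ∃ e, src e = v ∧ tgt e = w).Connected
  len : E → ℝ
  len_pos : ∀ e, 0 < len e

namespace Network

variable {V E : Type*}

/-- `e ∈ ℰ(v)`. -/
def Incident (N : Network V E) (e : E) (v : V) : Prop := N.src e = v ∨ N.tgt e = v

open Classical in
/-- `n_e(v)`. -/
def n (N : Network V E) (e : E) (v : V) : ℝ :=
  if v = N.src e then -1 else if v = N.tgt e then 1 else 0

open Classical in
/-- The coordinate in `[0, len e]` of the vertex `v` incident to `e`. -/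
def coord (N : Network V E) (e : E) (v : V) : ℝ := if v = N.src e then 0 else N.len e

/-- Boundary vertices, `|ℰ(v)| = 1`. -/
def IsBoundary (N : Network V E) (v : V) : Prop := {e | N.Incident e v}.ncard = 1

/-- Boundary vertices out of which their edge leads. -/
def IsInflow (N : Network V E) (v : V) : Prop :=
  N.IsBoundary v ∧ ∀ e, N.Incident e v → N.n e v < 0

open Classical in
/-- Admissible flow velocities: bounds and conservation at the interior vertices. -/
structure IsFlow [Fintype E] (N : Network V E) (bLow bUp : ℝ) (b : E → ℝ) : Prop where
  lower : ∀ e, bLow ≤ b e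
  upper : ∀ e, b e ≤ bUp
  conservation : ∀ v, ¬ N.IsBoundary v → ∑ e with N.Incident e v, b e * N.n e v = 0

open Classical in
/-- Boundary data in `C^{m+2}([0, tmax]; ℓ²(𝒱_∂))` whose derivatives up to order `m` vanish at
`t = 0`. -/
structure IsBoundaryData [Fintype V] (N : Network V E) (tmax : ℝ) (m : ℕ)
    (g : ℝ → {v // N.IsBoundary v} → ℝ) : Prop where
  smooth : ContDiffOn ℝ ((m + 2 : ℕ) : WithTop ℕ∞) g (Icc 0 tmax)
  vanish : ∀ j ≤ m, iteratedDerivWithin j g (Icc 0 tmax) 0 = 0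

open Classical in
/-- `(u, û)` is a solution of the convection-diffusion problem on the network with initial value
zero, in the class `C¹([0, tmax]; L²) ∩ C⁰([0, tmax]; H²_pw)`. -/
structure IsSolution [Fintype E] (N : Network V E) (b : E → ℝ) (ε tmax : ℝ)
    (g : ℝ → {v // N.IsBoundary v} → ℝ)
    (u : (e : E) → ℝ → Sobolev 2 0 (N.len e) ℝ) (uhat : ℝ → {v // ¬ N.IsBoundary v} → ℝ) :
    Prop where
  continuous : ∀ e, ContinuousOn (u e) (Icc 0 tmax)
  contDiff : ∀ e, ContDiffOn ℝ 1 (fun t => wd (u e t) 0) (Icc 0 tmax)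
  initial : ∀ e, u e 0 = 0
  equation : ∀ e, ∀ t ∈ Ioo 0 tmax,
    derivWithin (fun s => wd (u e s) 0) (Icc 0 tmax) t + b e • (wd (u e t) 1) = ε • (wd (u e t) 2)
  boundary : ∀ (v : V) (hv : N.IsBoundary v) (e : E), N.Incident e v → ∀ t ∈ Ioo 0 tmax,
    ptVal ((wd (u e t) 0)) (N.coord e v) = g t ⟨v, hv⟩
  coupling : ∀ (v : V) (hv : ¬ N.IsBoundary v) (e : E), N.Incident e v → ∀ t ∈ Ioo 0 tmax,
    ptVal ((wd (u e t) 0)) (N.coord e v) = uhat t ⟨v, hv⟩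
  conservation : ∀ v, ¬ N.IsBoundary v → ∀ t ∈ Ioo 0 tmax,
    ∑ e with N.Incident e v, (b e * ptVal ((wd (u e t) 0)) (N.coord e v)
      - ε * ptVal ((wd (u e t) 1)) (N.coord e v)) * N.n e v = 0

/-! ### Meshes and the hybrid dG method -/

/-- A mesh: every edge `e` is split into `num e` elements by
`0 = pt e 0 < pt e 1 < ⋯ < pt e (num e) = len e`. -/
structure Mesh (N : Network V E) where
  num : E → ℕ
  pt : (e : E) → Fin (num e + 1) → ℝ
  strictMono : ∀ e, StrictMono (pt e)
  pt_zero : ∀ e, pt e 0 = 0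
  pt_last : ∀ e, pt e (Fin.last (num e)) = N.len e

namespace Mesh

variable {N : Network V E}

/-- Left end point of the element `i` of the edge `e`. -/
def left (T : N.Mesh) (e : E) (i : Fin (T.num e)) : ℝ := T.pt e i.castSucc

/-- Right end point of the element `i` of the edge `e`. -/
def right (T : N.Mesh) (e : E) (i : Fin (T.num e)) : ℝ := T.pt e i.succ

/-- Element size `h_T`. -/
def size (T : N.Mesh) (e : E) (i : Fin (T.num e)) : ℝ := T.right e i - T.left e i

/-- The set `𝒱 ∪ 𝒳_h` of vertices and mesh points in the interior of the edges. -/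
abbrev Node (T : N.Mesh) : Type _ :=
  V ⊕ (Σ e : E, {j : Fin (T.num e + 1) // j ≠ 0 ∧ j ≠ Fin.last (T.num e)})

/-- Identification of the mesh point `j` of the edge `e` with an element of `𝒱 ∪ 𝒳_h`. -/
def node (T : N.Mesh) (e : E) (j : Fin (T.num e + 1)) : T.Node :=
  if h0 : j = 0 then Sum.inl (N.src e)
  else if h1 : j = Fin.last (T.num e) then Sum.inl (N.tgt e)
  else Sum.inr ⟨e, j, h0, h1⟩

/-- The space `W_h` of piecewise polynomials of degree at most `k`, given by the coefficients
on each element. -/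
abbrev DG (T : N.Mesh) (k : ℕ) : Type _ := (e : E) → Fin (T.num e) → Fin (k + 1) → ℝ

/-- The polynomial that `w ∈ W_h` is equal to on the element `i` of the edge `e`. -/
def poly {T : N.Mesh} {k : ℕ} (w : T.DG k) (e : E) (i : Fin (T.num e)) : ℝ[X] :=
  ∑ j : Fin (k + 1), Polynomial.C (w e i j) * Polynomial.X ^ (j : ℕ)

/-- The functions on `𝒱 ∪ 𝒳_h` that vanish on `𝒱_∂`. -/
def hybrid (T : N.Mesh) : Set (T.Node → ℝ) :=
  {w | ∀ v, N.IsBoundary v → w (Sum.inl v) = 0}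

/-- The index of the left (`false`) or right (`true`) end point of the element `i`. -/
def bd (T : N.Mesh) (e : E) (i : Fin (T.num e)) (s : Bool) : Fin (T.num e + 1) :=
  if s then i.succ else i.castSucc

/-- The outward normal at the left (`false`) or right (`true`) end point of an element. -/
def normal (s : Bool) : ℝ := if s then 1 else -1

/-- Sum over all elements. -/
def elemSum [Fintype E] {M : Type*} [AddCommMonoid M] (T : N.Mesh)
    (F : (e : E) → Fin (T.num e) → M) : M :=
  ∑ e, ∑ i, F e i

/-- Sum over all end points of all elements. -/
def bdSum [Fintype E] (T : N.Mesh) (F : (e : E) → Fin (T.num e) → Bool → ℝ) : ℝ :=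
  T.elemSum fun e i => ∑ s : Bool, F e i s

/-- The scalar product `(u, w)_{𝒯_h}`. -/
def innerProd [Fintype E] (T : N.Mesh) {k : ℕ} (u w : T.DG k) : ℝ :=
  T.elemSum fun e i =>
    ∫ x in (T.left e i)..(T.right e i), (poly u e i).eval x * (poly w e i).eval x

/-- Value of `w ∈ W_h` at an end point of an element, taken from inside the element. -/
def val (T : N.Mesh) {k : ℕ} (w : T.DG k) (e : E) (i : Fin (T.num e)) (s : Bool) : ℝ :=
  (poly w e i).eval (T.pt e (T.bd e i s))

/-- Derivative of `w ∈ W_h` at an end point of an element, taken from inside the element. -/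
def dval (T : N.Mesh) {k : ℕ} (w : T.DG k) (e : E) (i : Fin (T.num e)) (s : Bool) : ℝ :=
  (poly w e i).derivative.eval (T.pt e (T.bd e i s))

/-- Value of a hybrid function at an end point of an element. -/
def hval (T : N.Mesh) (w : T.Node → ℝ) (e : E) (i : Fin (T.num e)) (s : Bool) : ℝ :=
  w (T.node e (T.bd e i s))

/-- The convective bilinear form `b_h`, with the upwind flux
`n b u^up = max (n b) 0 u + min (n b) 0 û`. -/
def bForm [Fintype E] (T : N.Mesh) {k : ℕ} (b : E → ℝ) (u : T.DG k) (uhat : T.Node → ℝ)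
    (w : T.DG k) (what : T.Node → ℝ) : ℝ :=
  - T.elemSum (fun e i => ∫ x in (T.left e i)..(T.right e i),
      b e * (poly u e i).eval x * (poly w e i).derivative.eval x)
  + T.bdSum (fun e i s =>
      (max (normal s * b e) 0 * T.val u e i s + min (normal s * b e) 0 * T.hval uhat e i s)
        * (T.val w e i s - T.hval what e i s))

/-- The diffusive bilinear form `d_h` with stabilization parameter `α`. -/
def dForm [Fintype E] (T : N.Mesh) {k : ℕ} (α : ℝ) (u : T.DG k) (uhat : T.Node → ℝ)
    (w : T.DG k) (what : T.Node → ℝ) : ℝ :=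
  T.elemSum (fun e i => ∫ x in (T.left e i)..(T.right e i),
      (poly u e i).derivative.eval x * (poly w e i).derivative.eval x)
  - T.bdSum (fun e i s =>
      normal s * T.dval u e i s * (T.val w e i s - T.hval what e i s))
  + T.bdSum (fun e i s =>
      normal s * (T.val u e i s - T.hval uhat e i s) * T.dval w e i s)
  + T.bdSum (fun e i s =>
      α / T.size e i * (T.val u e i s - T.hval uhat e i s)
        * (T.val w e i s - T.hval what e i s))

open Classical in
/-- Boundary values as a function on `𝒱 ∪ 𝒳_h`, extended by zero from `𝒱_∂`. -/
def bdData (T : N.Mesh) (g : {v // N.IsBoundary v} → ℝ) : T.Node → ℝ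
  | Sum.inl v => if h : N.IsBoundary v then g ⟨v, h⟩ else 0
  | Sum.inr _ => 0

open Classical in
/-- The same, extended by zero from `𝒱_∂^in`. -/
def inData (T : N.Mesh) (g : {v // N.IsBoundary v} → ℝ) : T.Node → ℝ
  | Sum.inl v => if h : N.IsInflow v then g ⟨v, h.1⟩ else 0
  | Sum.inr _ => 0

/-- The linear form `ℓ_h`, consisting of sums over the boundary vertices; the sign of the term
with `∂ₓ w` is the one that makes the method consistent. -/
def lForm [Fintype E] (T : N.Mesh) {k : ℕ} (b : E → ℝ) (ε α : ℝ)
    (g : {v // N.IsBoundary v} → ℝ) (w : T.DG k) : ℝ :=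
  - T.bdSum (fun e i s => normal s * b e * T.hval (T.inData g) e i s * T.val w e i s)
  + T.bdSum (fun e i s => normal s * ε * T.hval (T.bdData g) e i s * T.dval w e i s)
  + T.bdSum (fun e i s =>
      α * ε / T.size e i * T.hval (T.bdData g) e i s * T.val w e i s)

/-- `(uh, uhhat)` is a solution of the semi-discrete hybrid dG method. -/
structure IsDiscreteSolution [Fintype E] (T : N.Mesh) {k : ℕ} (b : E → ℝ)
    (ε α tmax : ℝ) (g : ℝ → {v // N.IsBoundary v} → ℝ) (uh : ℝ → T.DG k)
    (uhhat : ℝ → T.Node → ℝ) : Prop where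
  contDiff : ContDiffOn ℝ 1 uh (Icc 0 tmax)
  initial : uh 0 = 0
  hybrid_continuous : ContinuousOn uhhat (Icc 0 tmax)
  hybrid_mem : ∀ t ∈ Icc 0 tmax, uhhat t ∈ T.hybrid
  equation : ∀ t ∈ Icc 0 tmax, ∀ (w : T.DG k), ∀ what ∈ T.hybrid,
    T.innerProd (derivWithin uh (Icc 0 tmax) t) w + T.bForm b (uh t) (uhhat t) w what
      + ε * T.dForm α (uh t) (uhhat t) w what = T.lForm b ε α (g t) w

/-- `‖u - w‖²_{L²(ℰ)}` for `u ∈ L²(ℰ)` and `w ∈ W_h`, summed over the elements. -/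
def errorSq [Fintype E] (T : N.Mesh) {k : ℕ} (u : (e : E) → L2 0 (N.len e) ℝ) (w : T.DG k) :
    ℝ≥0∞ :=
  T.elemSum fun e i => ∫⁻ x in Ioo (T.left e i) (T.right e i),
    ‖u e x - (poly w e i).eval x‖ₑ ^ 2

end Mesh

end Network

end HybridDG

end

noncomputable section

namespace HybridDG

/-! ### Primitives on intervals -/

/-! Split the error on each element with the Gauss-Radau projection Π, which matches moments against
polynomials of degree less than `k` and the value at the right end. All velocities are positive, so
the right end is the outflow end. Put η = u - Πu and θ = u_h - Πu. Integration by parts, continuity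
at the nodes and the flux balance at the vertices show that the exact solution with its nodal values
satisfies the same variational identity as the discrete one. The identities are subtracted element
by element and tested with θ and with the nodal error ζ of the hybrid variable (`energy_step`).

Convection: orthogonality removes ∫ηθ' and the matched outflow value removes the upwind trace of η.
What remains is a sum of nonnegative squares and the differences b(ζ_r² - ζ_l²)/2, which telescope
along each edge and cancel at interior vertices because the flow is conserved.

Diffusion: the antisymmetric trace terms cancel for θ. The surviving trace η(a)θ'(a) equals -∫η'θ',
since η vanishes at the right end and is orthogonal to θ''. Hence no inverse inequality is needed:
∫η'θ' is absorbed by ∫θ'², and the other traces of η by the stabilization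
(`elemForm_sub_elemExact_ge`).

Projection estimates: testing η with derivatives of suitable bubble polynomials shows that η and its
derivatives up to order `k` all have zeros in the closed element. Integrating from these zeros
bounds η and η' pointwise by the derivative of order `k + 1`, with explicit powers of the element
size and constant one (`abs_le_of_orthogonal`).

Time: Π is a bounded linear map on H^{k+1}, so it commutes with integration in time. With zero
initial value, `timePrim` is a time-continuous version of the exact solution with values in
H^{k+1}(T), which gives the estimates at every time. The energy inequality is integrated up to the
time of the maximum of ‖θ‖², whose contribution is absorbed in place of a Gronwall argument
(`le_of_isPrimitive_of_ae_le`). -/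

/-- `f` is a primitive of the integrable function `f'` on `[a, b]`. -/
structure IsPrimitive {X : Type*} [NormedAddCommGroup X] [NormedSpace ℝ X]
    (a b : ℝ) (f f' : ℝ → X) : Prop where
  integrable : IntervalIntegrable f' volume a b
  eq_add_integral : ∀ x ∈ Icc a b, f x = f a + ∫ y in a..x, f' y

namespace IsPrimitive

section Vector

variable {X : Type*} [NormedAddCommGroup X] [NormedSpace ℝ X] {a b : ℝ} {f f' : ℝ → X}

theorem continuousOn (h : IsPrimitive a b f f') (hab : a ≤ b) : ContinuousOn f (Icc a b) := by
  have h1 : ContinuousOn (fun x => f a + ∫ y in a..x, f' y) (Icc a b) := by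
    refine continuousOn_const.add ?_
    have := intervalIntegral.continuousOn_primitive_interval' h.integrable
      (left_mem_uIcc (a := a) (b := b))
    rwa [uIcc_of_le hab] at this
  exact h1.congr h.eq_add_integral

theorem intervalIntegrable_sub (h : IsPrimitive a b f f') {c d : ℝ} (hc : c ∈ Icc a b)
    (hd : d ∈ Icc a b) : IntervalIntegrable f' volume c d := by
  refine h.integrable.mono_set ?_
  rw [uIcc_of_le (hc.1.trans hc.2)]
  exact uIcc_subset_Icc hc hd

theorem sub_eq_integral (h : IsPrimitive a b f f') {c d : ℝ} (hc : c ∈ Icc a b)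
    (hd : d ∈ Icc a b) : f d - f c = ∫ y in c..d, f' y := by
  have ha : a ∈ Icc a b := ⟨le_rfl, hc.1.trans hc.2⟩
  rw [h.eq_add_integral d hd, h.eq_add_integral c hc,
    ← intervalIntegral.integral_interval_sub_left (h.intervalIntegrable_sub ha hd)
      (h.intervalIntegrable_sub ha hc)]
  abel

theorem mono (h : IsPrimitive a b f f') {c d : ℝ} (hc : c ∈ Icc a b) (hd : d ∈ Icc a b) :
    IsPrimitive c d f f' := by
  refine ⟨h.intervalIntegrable_sub hc hd, fun x hx => ?_⟩
  rw [← h.sub_eq_integral hc ⟨hc.1.trans hx.1, hx.2.trans hd.2⟩]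
  abel

theorem sub {g g' : ℝ → X} (hf : IsPrimitive a b f f') (hg : IsPrimitive a b g g') :
    IsPrimitive a b (fun x => f x - g x) (fun x => f' x - g' x) := by
  refine ⟨hf.integrable.sub hg.integrable, fun x hx => ?_⟩
  have ha : a ∈ Icc a b := ⟨le_rfl, hx.1.trans hx.2⟩
  rw [intervalIntegral.integral_sub (hf.intervalIntegrable_sub ha hx)
    (hg.intervalIntegrable_sub ha hx), hf.eq_add_integral x hx, hg.eq_add_integral x hx]
  abel

theorem clm {Y : Type*} [NormedAddCommGroup Y] [NormedSpace ℝ Y] [CompleteSpace X]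
    [CompleteSpace Y]
    (h : IsPrimitive a b f f') (L : X →L[ℝ] Y) :
    IsPrimitive a b (fun x => L (f x)) (fun x => L (f' x)) := by
  refine ⟨⟨L.integrable_comp h.integrable.1, L.integrable_comp h.integrable.2⟩, fun x hx => ?_⟩
  have ha : a ∈ Icc a b := ⟨le_rfl, hx.1.trans hx.2⟩
  rw [L.intervalIntegral_comp_comm (h.intervalIntegrable_sub ha hx), ← map_add,
    ← h.eq_add_integral x hx]

theorem of_hasDerivAt [CompleteSpace X] (hf : ∀ x, HasDerivAt f (f' x) x)
    (hf' : Continuous f') : IsPrimitive a b f f' := by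
  refine ⟨hf'.intervalIntegrable _ _, fun x _ => ?_⟩
  rw [intervalIntegral.integral_eq_sub_of_hasDerivAt (fun y _ => hf y)
    (hf'.intervalIntegrable _ _)]
  abel

end Vector

variable {a b : ℝ} {f f' g g' : ℝ → ℝ}

theorem poly (p : ℝ[X]) : IsPrimitive a b (fun x => p.eval x) (fun x => p.derivative.eval x) :=
  of_hasDerivAt (fun x => p.hasDerivAt x) p.derivative.continuous

theorem absolutelyContinuous (h : IsPrimitive a b f f') :
    AbsolutelyContinuousOnInterval (fun x => f a + ∫ y in a..x, f' y) a b := by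
  have h1 := h.integrable.absolutelyContinuousOnInterval_intervalIntegral
    (left_mem_uIcc (a := a) (b := b))
  have h2 : AbsolutelyContinuousOnInterval (fun _ : ℝ => f a) a b :=
    (contDiff_const.contDiffOn).absolutelyContinuousOnInterval
  exact h2.add h1

/-- A primitive of an integrable function is absolutely continuous, so the product rule for such
functions applies; the Lebesgue differentiation theorem identifies the derivatives almost
everywhere. -/
theorem integral_mul (hf : IsPrimitive a b f f') (hg : IsPrimitive a b g g') (hab : a ≤ b) :
    ∫ x in a..b, (f' x * g x + f x * g' x) = f b * g b - f a * g a := by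
  have h := hf.absolutelyContinuous.integral_deriv_mul_eq_sub hg.absolutelyContinuous
  have hb : b ∈ Icc a b := ⟨hab, le_rfl⟩
  simp only [intervalIntegral.integral_same, add_zero] at h
  rw [← hf.eq_add_integral b hb, ← hg.eq_add_integral b hb] at h
  rw [← h]
  refine intervalIntegral.integral_congr_ae ?_
  filter_upwards [hf.integrable.ae_hasDerivAt_integral, hg.integrable.ae_hasDerivAt_integral]
    with x h1 h2 hx
  have hx' : x ∈ uIcc a b := uIoc_subset_uIcc hx
  have e1 := ((h1 hx' a left_mem_uIcc).const_add (f a)).deriv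
  have e2 := ((h2 hx' a left_mem_uIcc).const_add (g a)).deriv
  rw [uIcc_of_le hab] at hx'
  rw [e1, e2, ← hf.eq_add_integral x hx', ← hg.eq_add_integral x hx']

theorem mul (hf : IsPrimitive a b f f') (hg : IsPrimitive a b g g') (hab : a ≤ b) :
    IsPrimitive a b (fun x => f x * g x) (fun x => f' x * g x + f x * g' x) := by
  have hc := hf.continuousOn hab
  have hd := hg.continuousOn hab
  rw [← uIcc_of_le hab] at hc hd
  refine ⟨(hf.integrable.mul_continuousOn hd).add (hg.integrable.continuousOn_mul hc),
    fun x hx => ?_⟩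
  have ha : a ∈ Icc a b := ⟨le_rfl, hab⟩
  rw [(hf.mono ha hx).integral_mul (hg.mono ha hx) hx.1]
  ring

theorem integral_mul_eq (hf : IsPrimitive a b f f') (hg : IsPrimitive a b g g') (hab : a ≤ b) :
    ∫ x in a..b, f' x * g x = f b * g b - f a * g a - ∫ x in a..b, f x * g' x := by
  have hc := hf.continuousOn hab
  have hd := hg.continuousOn hab
  rw [← uIcc_of_le hab] at hc hd
  rw [← hf.integral_mul hg hab, intervalIntegral.integral_add
    (hf.integrable.mul_continuousOn hd) (hg.integrable.continuousOn_mul hc)]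
  ring

end IsPrimitive

/-! ### Weak derivatives and primitives -/

section WeakDeriv

variable {a b : ℝ} {X : Type*} [NormedAddCommGroup X]

theorem L2.integrableOn (f : L2 a b X) : IntegrableOn f (Ioo a b) volume := by
  have : IsFiniteMeasure (volume.restrict (Ioo a b)) := ⟨by simp⟩
  exact (Lp.memLp f).integrable (by norm_num)

theorem L2.intervalIntegrable (f : L2 a b X) (hab : a ≤ b) : IntervalIntegrable f volume a b :=
  (intervalIntegrable_iff_integrableOn_Ioo_of_le hab).2 (L2.integrableOn f)

variable [NormedSpace ℝ X]

theorem L2.isPrimitive (f : L2 a b X) (hab : a ≤ b) (c : X) :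
    IsPrimitive a b (fun x => c + ∫ y in a..x, f y) f :=
  ⟨L2.intervalIntegrable f hab, fun x _ => by simp⟩

theorem integral_Ioo_eq (hab : a ≤ b) (f : ℝ → X) :
    ∫ x in Ioo a b, f x = ∫ x in a..b, f x := by
  rw [intervalIntegral.integral_of_le hab, integral_Ioc_eq_integral_Ioo]

theorem IsTest.eq_zero {φ : ℝ → ℝ} (h : IsTest a b φ) {x : ℝ} (hx : x ∉ Ioo a b) : φ x = 0 := by
  by_contra h0
  exact hx (h.2.2 (subset_tsupport _ h0))

theorem IsTest.deriv_isTest {φ : ℝ → ℝ} (h : IsTest a b φ) : IsTest a b (deriv φ) :=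
  ⟨(contDiff_infty_iff_deriv.1 h.1).2, h.2.1.deriv, (tsupport_deriv_subset (𝕜 := ℝ)).trans h.2.2⟩

theorem IsTest.isPrimitive {φ : ℝ → ℝ} (h : IsTest a b φ) (c d : ℝ) :
    IsPrimitive c d φ (deriv φ) :=
  IsPrimitive.of_hasDerivAt
    (fun x => (h.1.differentiable (by simp) x).hasDerivAt)
    (h.1.continuous_deriv (by exact_mod_cast le_top))

/-- Continuous linear functionals separate points, which reduces the vector-valued formula to scalar
integration by parts; the boundary terms vanish since φ does. -/
theorem integral_deriv_smul_primitive [CompleteSpace X] {f f' : ℝ → X} (hab : a ≤ b)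
    (hf : IsPrimitive a b f f') {φ : ℝ → ℝ} (h : IsTest a b φ) :
    ∫ x in a..b, deriv φ x • f x = - ∫ x in a..b, φ x • f' x := by
  have hfc := hf.continuousOn hab
  rw [← uIcc_of_le hab] at hfc
  have hi1 : IntervalIntegrable (fun x => deriv φ x • f x) volume a b :=
    ((h.1.continuous_deriv (by exact_mod_cast le_top)).continuousOn.smul hfc).intervalIntegrable
  have hi2 : IntervalIntegrable (fun x => φ x • f' x) volume a b :=
    hf.integrable.continuousOn_smul h.1.continuous.continuousOn
  rw [← add_eq_zero_iff_eq_neg]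
  refine SeparatingDual.eq_zero_of_forall_dual_eq_zero (R := ℝ) fun L => ?_
  rw [map_add, ← L.intervalIntegral_comp_comm hi1, ← L.intervalIntegral_comp_comm hi2]
  have := (h.isPrimitive a b).integral_mul_eq (hf.clm L) hab
  rw [h.eq_zero (x := a) (by simp), h.eq_zero (x := b) (by simp)] at this
  simp only [map_smul, smul_eq_mul, this]
  ring

/-- Vanishing mean makes the primitive zero on both sides of the support of θ, so it is again a test
function. -/
theorem IsTest.primitive {θ : ℝ → ℝ} (h : IsTest a b θ) (hab : a < b)
    (h0 : ∫ x in a..b, θ x = 0) :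
    IsTest a b (fun x => ∫ y in a..x, θ y) ∧ deriv (fun x => ∫ y in a..x, θ y) = θ := by
  have hd : ∀ x, HasDerivAt (fun x => ∫ y in a..x, θ y) (θ x) x := fun x =>
    intervalIntegral.integral_hasDerivAt_right (h.1.continuous.intervalIntegrable _ _)
      (h.1.continuous.stronglyMeasurableAtFilter _ _) h.1.continuous.continuousAt
  have hderiv : deriv (fun x => ∫ y in a..x, θ y) = θ := funext fun x => (hd x).deriv
  obtain ⟨c, d, hac, hdb, hcd, hsub⟩ : ∃ c d, a < c ∧ d < b ∧ c ≤ d ∧ tsupport θ ⊆ Icc c d := by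
    rcases (tsupport θ).eq_empty_or_nonempty with he | hne
    · exact ⟨(a + b) / 2, (a + b) / 2, by linarith, by linarith, le_rfl, by simp [he]⟩
    · have hK : IsCompact (tsupport θ) := h.2.1
      have h1 := hK.sInf_mem hne
      have h2 := hK.sSup_mem hne
      exact ⟨sInf (tsupport θ), sSup (tsupport θ), (h.2.2 h1).1, (h.2.2 h2).2,
        csInf_le hK.bddBelow h2, fun x hx => ⟨csInf_le hK.bddBelow hx, le_csSup hK.bddAbove hx⟩⟩
  have hz : ∀ x, x ∉ Icc c d → θ x = 0 := fun x hx => by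
    by_contra hne
    exact hx (hsub (subset_tsupport _ hne))
  have hii : ∀ x y, IntervalIntegrable θ volume x y :=
    fun x y => h.1.continuous.intervalIntegrable _ _
  have hl : ∀ x ≤ c, ∫ y in a..x, θ y = 0 := fun x hx => by
    refine (intervalIntegral.integral_congr_ae (g := fun _ => 0) ?_).trans (by simp)
    filter_upwards [compl_mem_ae_iff.2 (measure_singleton c)] with y hy hyx
    refine hz y fun hy' => ?_
    rcases (mem_uIoc.1 hyx) with h1 | h1
    · exact hy (le_antisymm (h1.2.trans hx) hy'.1)
    · exact absurd (h1.2.trans_lt (hac.trans_le hy'.1)) (lt_irrefl _)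
  have hr : ∀ x, d ≤ x → ∫ y in a..x, θ y = 0 := fun x hx => by
    have : ∫ y in x..b, θ y = 0 := by
      refine (intervalIntegral.integral_congr_ae (g := fun _ => 0) ?_).trans (by simp)
      filter_upwards [compl_mem_ae_iff.2 (measure_singleton d)] with y hy hyx
      refine hz y fun hy' => ?_
      rcases (mem_uIoc.1 hyx) with h1 | h1
      · linarith [h1.1, hy'.2]
      · linarith [h1.1, hy'.2]
    rw [← intervalIntegral.integral_add_adjacent_intervals (hii a x) (hii x b), this] at h0
    linarith
  have hsupp : tsupport (fun x => ∫ y in a..x, θ y) ⊆ Icc c d := by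
    refine closure_minimal (fun x hx => ?_) isClosed_Icc
    by_contra hx'
    rw [mem_Icc, not_and_or, not_le, not_le] at hx'
    rcases hx' with h' | h'
    · exact hx (hl x h'.le)
    · exact hx (hr x h'.le)
  refine ⟨⟨contDiff_infty_iff_deriv.2 ⟨fun x => (hd x).differentiableAt, by rw [hderiv]; exact h.1⟩,
    IsCompact.of_isClosed_subset isCompact_Icc (isClosed_tsupport _) hsupp,
    hsupp.trans fun x hx => ⟨hac.trans_le hx.1, hx.2.trans_lt hdb⟩⟩, hderiv⟩

theorem exists_isTest_integral_eq_one (hab : a < b) :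
    ∃ φ, IsTest a b φ ∧ ∫ x in a..b, φ x = 1 := by
  have hm : (a + b) / 2 ∈ Ioo a b := ⟨by linarith, by linarith⟩
  obtain ⟨f, hf1, hf2, hf3, hf4, hf5⟩ :=
    exists_contDiff_tsupport_subset (n := ⊤) (isOpen_Ioo.mem_nhds hm)
  have hpos : 0 < ∫ x in a..b, f x := by
    rw [intervalIntegral.integral_of_le hab.le, integral_Ioc_eq_integral_Ioo,
      setIntegral_eq_integral_of_forall_compl_eq_zero (fun x hx => by
        by_contra h0
        exact hx (hf1 (subset_tsupport _ h0)))]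
    exact hf3.continuous.integral_pos_of_hasCompactSupport_nonneg_nonzero hf2
      (fun x => (hf4 ⟨x, rfl⟩).1) (x := (a + b) / 2) (by rw [hf5]; norm_num)
  refine ⟨fun x => (∫ x in a..b, f x)⁻¹ * f x, ⟨contDiff_const.mul hf3, hf2.mul_left, ?_⟩, ?_⟩
  · exact (tsupport_mul_subset_right).trans hf1
  · rw [intervalIntegral.integral_const_mul, inv_mul_cancel₀ hpos.ne']

theorem ae_eq_zero_of_forall_isTest [CompleteSpace X] {f : ℝ → X}
    (hf : IntegrableOn f (Ioo a b) volume)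
    (h : ∀ φ, IsTest a b φ → ∫ x in Ioo a b, φ x • f x = 0) :
    ∀ᵐ x ∂(volume.restrict (Ioo a b)), f x = 0 := by
  rw [ae_restrict_iff' measurableSet_Ioo]
  refine IsOpen.ae_eq_zero_of_integral_contDiff_smul_eq_zero isOpen_Ioo hf.locallyIntegrableOn ?_
  intro φ h1 h2 h3
  have ht : IsTest a b φ := ⟨h1, h2, h3⟩
  rw [← h φ ht, setIntegral_eq_integral_of_forall_compl_eq_zero]
  intro x hx
  rw [ht.eq_zero hx, zero_smul]

/-- An `L²` function with an `L²` weak derivative is almost everywhere equal to a primitive of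
its derivative. -/
theorem IsWeakDeriv.exists_ae_eq [CompleteSpace X] (hab : a < b) {f g : L2 a b X}
    (h : IsWeakDeriv 1 f g) :
    ∃ c : X, f =ᵐ[volume.restrict (Ioo a b)] fun x => c + ∫ y in a..x, g y := by
  -- Du Bois-Reymond argument: subtracting (∫φ)χ from any test function φ leaves the derivative of a
  -- test function. As `f - G` annihilates such derivatives, it is the constant ∫χ(f - G).
  obtain ⟨χ, hχ, hχ1⟩ := exists_isTest_integral_eq_one hab
  have hG := L2.isPrimitive g hab.le (0 : X)
  simp only [zero_add] at hG
  set G : ℝ → X := fun x => ∫ y in a..x, g y with hGdef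
  have hGi : IntervalIntegrable G volume a b :=
    ((hG.continuousOn hab.le).mono (uIcc_of_le hab.le).subset).intervalIntegrable
  set F : ℝ → X := fun x => f x - G x with hF
  have hFi : IntervalIntegrable F volume a b := (L2.intervalIntegrable f hab.le).sub hGi
  have hsm : ∀ {φ : ℝ → ℝ}, Continuous φ → ∀ {k : ℝ → X}, IntervalIntegrable k volume a b →
      IntervalIntegrable (fun x => φ x • k x) volume a b :=
    fun hφ _ hk => hk.continuousOn_smul hφ.continuousOn
  have h1 : ∀ φ, IsTest a b φ → ∫ x in a..b, deriv φ x • F x = 0 := by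
    intro φ hφ
    have e1 := h φ hφ
    have e2 := integral_deriv_smul_primitive hab.le hG hφ
    simp only [iteratedDeriv_one, pow_one, neg_smul, one_smul, integral_Ioo_eq hab.le] at e1
    simp only [hF, smul_sub]
    have hφc : Continuous (deriv φ) := hφ.deriv_isTest.1.continuous
    rw [intervalIntegral.integral_sub (hsm hφc (L2.intervalIntegrable f hab.le)) (hsm hφc hGi),
      e1, e2, sub_self]
  set c : X := ∫ x in a..b, χ x • F x with hc
  refine ⟨c, ?_⟩
  have h2 : ∀ᵐ x ∂(volume.restrict (Ioo a b)), F x - c = 0 := by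
    refine ae_eq_zero_of_forall_isTest ?_ fun φ hφ => ?_
    · exact (intervalIntegrable_iff_integrableOn_Ioo_of_le hab.le).1
        (hFi.sub intervalIntegrable_const)
    · set I : ℝ := ∫ x in a..b, φ x with hI
      have hθ : IsTest a b (fun x => φ x - I * χ x) := by
        refine ⟨hφ.1.sub (contDiff_const.mul hχ.1), hφ.2.1.sub hχ.2.1.mul_left, ?_⟩
        refine (tsupport_sub _ _).trans (union_subset hφ.2.2 ?_)
        exact (tsupport_mul_subset_right).trans hχ.2.2
      have hφi : IntervalIntegrable φ volume a b := hφ.1.continuous.intervalIntegrable _ _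
      have hχi : IntervalIntegrable χ volume a b := hχ.1.continuous.intervalIntegrable _ _
      have hθ0 : ∫ x in a..b, (φ x - I * χ x) = 0 := by
        rw [intervalIntegral.integral_sub hφi (hχi.const_mul I),
          intervalIntegral.integral_const_mul, hχ1, mul_one, sub_self]
      obtain ⟨hψ, hψd⟩ := hθ.primitive hab hθ0
      have e := h1 _ hψ
      rw [hψd] at e
      have e3 : ∫ x in a..b, (φ x • F x - I • (χ x • F x)) = 0 := by
        rw [← e]
        refine intervalIntegral.integral_congr fun x _ => ?_
        simp only [sub_smul, mul_smul]
      have hφF := hsm hφ.1.continuous hFi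
      have hχF := hsm hχ.1.continuous hFi
      rw [intervalIntegral.integral_sub hφF
        (show IntervalIntegrable (fun x => I • (χ x • F x)) volume a b from hχF.smul I),
        intervalIntegral.integral_smul, ← hc] at e3
      rw [integral_Ioo_eq hab.le]
      simp only [smul_sub]
      rw [intervalIntegral.integral_sub hφF (hsm hφ.1.continuous intervalIntegrable_const),
        intervalIntegral.integral_smul_const]
      exact e3
  filter_upwards [h2] with x hx
  have : f x - G x - c = 0 := hx
  rw [sub_sub, sub_eq_zero] at this
  rw [this, add_comm]

theorem IsWeakDeriv.eq [CompleteSpace X] {i : ℕ} {f g₁ g₂ : L2 a b X}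
    (h₁ : IsWeakDeriv i f g₁) (h₂ : IsWeakDeriv i f g₂) : g₁ = g₂ := by
  have h : ∀ᵐ x ∂(volume.restrict (Ioo a b)), (g₁ - g₂ : L2 a b X) x = 0 := by
    refine ae_eq_zero_of_forall_isTest (L2.integrableOn _) fun φ hφ => ?_
    have e : pairing hφ 0 g₁ = pairing hφ 0 g₂ := by
      have := ((isWeakDeriv_iff i f g₁).1 h₁ φ hφ).symm.trans ((isWeakDeriv_iff i f g₂).1 h₂ φ hφ)
      exact smul_right_injective X (pow_ne_zero i (by norm_num : (-1 : ℝ) ≠ 0)) this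
    have := pairing_apply hφ 0 (g₁ - g₂)
    rw [map_sub, e, sub_self, iteratedDeriv_zero] at this
    exact this.symm
  rw [← sub_eq_zero]
  refine Lp.ext ?_
  filter_upwards [h, Lp.coeFn_zero X 2 (volume.restrict (Ioo a b))] with x h1 h2
  rw [h1, h2, Pi.zero_apply]

theorem IsWeakDeriv.succ [CompleteSpace X] {i : ℕ} {f g₁ g₂ : L2 a b X}
    (h₁ : IsWeakDeriv i f g₁) (h₂ : IsWeakDeriv (i + 1) f g₂) : IsWeakDeriv 1 g₁ g₂ := by
  intro φ hφ
  have e1 := h₁ _ hφ.deriv_isTest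
  have e2 := h₂ _ hφ
  rw [← iteratedDeriv_succ', e2, pow_succ, mul_smul] at e1
  have e3 := smul_right_injective X (pow_ne_zero i (by norm_num : (-1 : ℝ) ≠ 0)) e1
  rw [iteratedDeriv_one, pow_one]
  exact e3.symm

variable [CompleteSpace X] {j : ℕ}

theorem Sobolev.isWeakDeriv (f : Sobolev j a b X) (i : Fin (j + 1)) :
    IsWeakDeriv (i : ℕ) (wd f 0) (wd f i) := f.2 i

theorem Sobolev.ext {f g : Sobolev j a b X} (h : wd f 0 = wd g 0) : f = g := by
  refine Subtype.ext ?_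
  ext1 i
  have hg := g.2 i
  have h' : f.1 0 = g.1 0 := h
  rw [← h'] at hg
  exact (f.2 i).eq hg

/-- The `i`-th weak derivative as a continuous linear map. -/
def wdL (j : ℕ) (a b : ℝ) (X : Type*) [NormedAddCommGroup X] [NormedSpace ℝ X] [CompleteSpace X]
    (i : Fin (j + 1)) : Sobolev j a b X →L[ℝ] L2 a b X :=
  (PiLp.proj 2 (fun _ : Fin (j + 1) => L2 a b X) i).comp (Sobolev j a b X).subtypeL

@[simp] theorem wdL_apply (f : Sobolev j a b X) (i : Fin (j + 1)) : wdL j a b X i f = wd f i := rfl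

theorem Sobolev.norm_wd_le (f : Sobolev j a b X) (i : Fin (j + 1)) : ‖wd f i‖ ≤ ‖f‖ :=
  PiLp.norm_apply_le (p := 2) f.1 i

end WeakDeriv

/-! ### Representatives of Sobolev functions -/

/-- `v` consists of the representatives of the derivatives of `f`, those of order less than `j`
being continuous. -/
structure IsRep {j : ℕ} {a b : ℝ} (f : Sobolev j a b ℝ) (v : ℕ → ℝ → ℝ) : Prop where
  ae_eq : ∀ i : Fin (j + 1), wd f i =ᵐ[volume.restrict (Ioo a b)] v i
  isPrimitive : ∀ i < j, IsPrimitive a b (v i) (v (i + 1))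

theorem exists_isRep {j : ℕ} {a b : ℝ} (hab : a < b) (f : Sobolev j a b ℝ) : ∃ v, IsRep f v := by
  have h : ∀ i : Fin j, ∃ c : ℝ, wd f i.castSucc =ᵐ[volume.restrict (Ioo a b)]
      fun x => c + ∫ y in a..x, wd f i.succ y := fun i =>
    ((Sobolev.isWeakDeriv f i.castSucc).succ (by simpa using Sobolev.isWeakDeriv f i.succ)).exists_ae_eq
      hab
  choose c hc using h
  -- Below order `j` the representative is a primitive of the next derivative. The top derivative is
  -- only an L² function and is kept as it is; its values at indices above `j` play no role.
  let v : ℕ → ℝ → ℝ := fun i => if hi : i < j then fun x => c ⟨i, hi⟩ +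
    ∫ y in a..x, wd f (Fin.succ ⟨i, hi⟩) y else wd f (Fin.last j)
  have hv : ∀ i : Fin (j + 1), wd f i =ᵐ[volume.restrict (Ioo a b)] v i := by
    intro i
    by_cases hi : (i : ℕ) < j
    · have : v i = fun x => c ⟨i, hi⟩ + ∫ y in a..x, wd f (Fin.succ ⟨i, hi⟩) y := dif_pos hi
      rw [this]
      exact hc ⟨i, hi⟩
    · have : v i = wd f (Fin.last j) := dif_neg hi
      rw [this]
      have : i = Fin.last j := by
        ext
        have := i.2
        simp only [Fin.val_last]
        omega
      rw [this]
  refine ⟨v, hv, fun i hi => ?_⟩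
  have h1 := hv (Fin.succ ⟨i, hi⟩)
  simp only [Fin.val_succ] at h1
  have h2 : v i = fun x => c ⟨i, hi⟩ + ∫ y in a..x, wd f (Fin.succ ⟨i, hi⟩) y := dif_pos hi
  have h1' : ∀ᵐ x, x ∈ Ioc a b → wd f (Fin.succ ⟨i, hi⟩) x = v (i + 1) x := by
    rw [← ae_restrict_iff' measurableSet_Ioc, ← restrict_Ioo_eq_restrict_Ioc]
    exact h1
  refine ⟨?_, fun x hx => ?_⟩
  · rw [intervalIntegrable_iff_integrableOn_Ioo_of_le hab.le]
    exact (L2.integrableOn _).congr h1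
  · simp only [h2, intervalIntegral.integral_same, add_zero]
    congr 1
    refine intervalIntegral.integral_congr_ae ?_
    filter_upwards [h1'] with y hy hy'
    rw [uIoc_of_le hx.1] at hy'
    exact hy ⟨hy'.1, hy'.2.trans hx.2⟩

/-! ### Norms and moments in `L²` -/

theorem L2.norm_sq_eq {a b : ℝ} {X : Type*} [NormedAddCommGroup X] (f : L2 a b X) :
    ‖f‖ ^ 2 = ∫ x in Ioo a b, ‖f x‖ ^ 2 := by
  rw [Lp.norm_def, (Lp.memLp f).eLpNorm_eq_integral_rpow_norm (by norm_num) (by norm_num)]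
  have h0 : 0 ≤ ∫ x in Ioo a b, ‖f x‖ ^ (2 : ℝ) := integral_nonneg fun x => by positivity
  simp only [ENNReal.toReal_ofNat]
  rw [ENNReal.toReal_ofReal (by positivity), ← Real.rpow_natCast, ← Real.rpow_mul h0]
  norm_num

theorem L2.integrableOn_norm_sq {a b : ℝ} {X : Type*} [NormedAddCommGroup X] (f : L2 a b X) :
    IntegrableOn (fun x => ‖f x‖ ^ 2) (Ioo a b) := by
  have := (Lp.memLp f).integrable_norm_rpow (by norm_num) (by norm_num)
  simpa [IntegrableOn] using this

/-- The continuous functional `f ↦ ∫ φ f` on `L²`. -/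
def momentL {a b : ℝ} (X : Type*) [NormedAddCommGroup X] [NormedSpace ℝ X] [CompleteSpace X]
    {φ : ℝ → ℝ} (hφ : MemLp φ 2 (volume.restrict (Ioo a b))) : L2 a b X →L[ℝ] X :=
  ContinuousLinearMap.lpPairing (volume.restrict (Ioo a b)) 2 2
    (ContinuousLinearMap.lsmul ℝ ℝ) (hφ.toLp _)

theorem momentL_apply {a b : ℝ} {X : Type*} [NormedAddCommGroup X] [NormedSpace ℝ X]
    [CompleteSpace X] {φ : ℝ → ℝ} (hφ : MemLp φ 2 (volume.restrict (Ioo a b))) (f : L2 a b X) :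
    momentL X hφ f = ∫ x in Ioo a b, φ x • f x := by
  unfold momentL
  rw [ContinuousLinearMap.lpPairing_eq_integral]
  refine integral_congr_ae ?_
  filter_upwards [hφ.coeFn_toLp] with x hx
  simp [hx]

theorem _root_.Continuous.memLp_Ioo {φ : ℝ → ℝ} (hφ : Continuous φ) (a b : ℝ) :
    MemLp φ 2 (volume.restrict (Ioo a b)) := by
  have : IsFiniteMeasure (volume.restrict (Ioo a b)) := ⟨by simp⟩
  obtain ⟨C, hC⟩ := isCompact_Icc.exists_bound_of_continuousOn (hφ.continuousOn (s := Icc a b))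
  refine MemLp.of_bound hφ.aestronglyMeasurable C ?_
  rw [ae_restrict_iff' measurableSet_Ioo]
  exact Filter.Eventually.of_forall fun x hx => hC x (Ioo_subset_Icc_self hx)

/-! ### Functions with vanishing moments -/

section Radau

variable {k : ℕ} {a b : ℝ} {v : ℕ → ℝ → ℝ}

/-- Integrate by parts `j` times. Each derivative costs one order of vanishing of ψ at each end. At
`b` one order less is required, because the last boundary term carries `v 0 b = 0`. -/
theorem integral_mul_bubble (hab : a ≤ b) (hv : ∀ i < k + 1, IsPrimitive a b (v i) (v (i + 1)))
    (hb : v 0 b = 0) : ∀ j ≤ k + 1, ∀ ψ : ℝ[X], (Polynomial.X - Polynomial.C a) ^ j ∣ ψ →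
      (Polynomial.C b - Polynomial.X) ^ (j - 1) ∣ ψ →
      ∫ x in a..b, v j x * ψ.eval x =
        (-1) ^ j * ∫ x in a..b, v 0 x * (Polynomial.derivative^[j] ψ).eval x := by
  intro j
  induction j with
  | zero => intro _ ψ _ _; simp
  | succ j ih =>
    intro hj ψ h1 h2
    rw [(hv j (by omega)).integral_mul_eq (IsPrimitive.poly ψ) hab]
    have ha : ψ.eval a = 0 := by
      obtain ⟨r, rfl⟩ := h1
      simp
    have hbb : v j b * ψ.eval b = 0 := by
      rcases Nat.eq_zero_or_pos j with rfl | hj0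
      · rw [hb, zero_mul]
      · obtain ⟨r, rfl⟩ := h2
        have : j ≠ 0 := by omega
        simp [this]
    have d1 := Polynomial.pow_sub_one_dvd_derivative_of_pow_dvd h1
    have d2 := Polynomial.pow_sub_one_dvd_derivative_of_pow_dvd h2
    rw [ih (by omega) _ d1 d2, ha, hbb, Function.iterate_succ_apply, pow_succ]
    ring

/-- By the intermediate value theorem a zero-free continuous `f` keeps its sign, and its integral
against a weight positive inside could not vanish. -/
theorem exists_zero_of_integral_eq_zero (hab : a < b) {f ψ : ℝ → ℝ}
    (hf : ContinuousOn f (Icc a b)) (hψ : ContinuousOn ψ (Icc a b))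
    (hpos : ∀ x ∈ Ioo a b, 0 < ψ x) (h0 : ∫ x in a..b, f x * ψ x = 0) :
    ∃ z ∈ Icc a b, f z = 0 := by
  by_contra! hne
  have key : ∀ g : ℝ → ℝ, ContinuousOn g (Icc a b) → (∀ x ∈ Icc a b, 0 < g x) →
      0 < ∫ x in a..b, g x * ψ x := fun g hg hgp => by
    refine intervalIntegral.intervalIntegral_pos_of_pos_on ?_ (fun x hx => ?_) hab
    · refine ContinuousOn.intervalIntegrable ?_
      rw [uIcc_of_le hab.le]
      exact hg.mul hψ
    · exact mul_pos (hgp x (Ioo_subset_Icc_self hx)) (hpos x hx)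
  have ha : a ∈ Icc a b := ⟨le_rfl, hab.le⟩
  have hconn : ∀ x ∈ Icc a b, ∀ y ∈ Icc a b, f x < 0 → 0 < f y → False := by
    intro x hx y hy h1 h2
    obtain ⟨z, hz, hz0⟩ := isPreconnected_Icc.intermediate_value hx hy hf ⟨h1.le, h2.le⟩
    exact hne z hz hz0
  rcases lt_or_gt_of_ne (hne a ha) with h | h
  · have := key (fun x => - f x) hf.neg fun x hx => by
      rcases lt_or_gt_of_ne (hne x hx) with h' | h'
      · simpa using h'
      · exact (hconn a ha x hx h h').elim
    simp only [neg_mul, intervalIntegral.integral_neg, h0, neg_zero, lt_irrefl] at this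
  · have := key f hf fun x hx => by
      rcases lt_or_gt_of_ne (hne x hx) with h' | h'
      · exact (hconn x hx a ha h' h).elim
      · exact h'
    exact this.ne' h0

/-- The bubble (x - a)^j (b - x)^(j-1) has degree 2j - 1, so its `j`-th derivative has degree at
most j - 1 < k and is annihilated by `v 0`. Moving the derivatives to `v` gives a vanishing integral
of `v j` against a positive weight. The exponent j - 1 is what keeps the degree below `k` also for
`j = k`. -/
theorem exists_zero_of_orthogonal (hab : a < b)
    (hv : ∀ i < k + 1, IsPrimitive a b (v i) (v (i + 1))) (hb : v 0 b = 0)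
    (horth : ∀ q : ℝ[X], q.natDegree < k → ∫ x in a..b, v 0 x * q.eval x = 0) (j : ℕ)
    (hj : j ≤ k) : ∃ z ∈ Icc a b, v j z = 0 := by
  rcases Nat.eq_zero_or_pos j with rfl | hj0
  · exact ⟨b, ⟨hab.le, le_rfl⟩, hb⟩
  set ψ : ℝ[X] := (Polynomial.X - Polynomial.C a) ^ j * (Polynomial.C b - Polynomial.X) ^ (j - 1)
    with hψ
  have h1 := integral_mul_bubble hab.le hv hb j (by omega) ψ (dvd_mul_right _ _) (dvd_mul_left _ _)
  have hdeg : (Polynomial.derivative^[j] ψ).natDegree < k := by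
    have e1 : ψ.natDegree ≤ j + (j - 1) := by
      refine Polynomial.natDegree_mul_le.trans (add_le_add ?_ ?_)
      · refine Polynomial.natDegree_pow_le.trans ?_
        simp
      · refine Polynomial.natDegree_pow_le.trans ?_
        rw [← neg_sub, Polynomial.natDegree_neg]
        simp
    have e2 := Polynomial.natDegree_iterate_derivative ψ j
    omega
  rw [horth _ hdeg, mul_zero] at h1
  refine exists_zero_of_integral_eq_zero hab ((hv j (by omega)).continuousOn hab.le)
    ψ.continuous.continuousOn (fun x hx => ?_) h1
  simp only [hψ, Polynomial.eval_mul, Polynomial.eval_pow, Polynomial.eval_sub, Polynomial.eval_X,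
    Polynomial.eval_C]
  exact mul_pos (pow_pos (sub_pos.2 hx.1) _) (pow_pos (sub_pos.2 hx.2) _)

/-- Every derivative up to order `k` has a zero and is therefore the integral, from that zero, of
the next one. The first integration gives the L¹ norm of `v (k + 1)`, each further one a factor `b -
a`. The index `k - j` lets the induction descend from the top. -/
theorem abs_le_of_orthogonal (hab : a < b)
    (hv : ∀ i < k + 1, IsPrimitive a b (v i) (v (i + 1))) (hb : v 0 b = 0)
    (horth : ∀ q : ℝ[X], q.natDegree < k → ∫ x in a..b, v 0 x * q.eval x = 0) :
    ∀ j ≤ k, ∀ x ∈ Icc a b, |v (k - j) x| ≤ (b - a) ^ j * ∫ x in a..b, |v (k + 1) x| := by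
  intro j
  induction j with
  | zero =>
    intro _ x hx
    obtain ⟨z, hz, hz0⟩ := exists_zero_of_orthogonal hab hv hb horth k le_rfl
    have h := (hv k (by omega)).sub_eq_integral hz hx
    rw [hz0, sub_zero] at h
    rw [Nat.sub_zero, h, pow_zero, one_mul]
    refine (intervalIntegral.norm_integral_le_abs_integral_norm (f := v (k + 1))).trans ?_
    have hsub : uIoc z x ⊆ uIoc a b := by
      rw [uIoc_of_le hab.le]
      exact fun y hy => ⟨(le_min hz.1 hx.1).trans_lt hy.1, hy.2.trans (max_le hz.2 hx.2)⟩
    have hmono := intervalIntegral.abs_integral_mono_interval (f := fun y => ‖v (k + 1) y‖)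
      (μ := volume) hsub (Filter.Eventually.of_forall fun x => norm_nonneg _)
      (hv k (by omega)).integrable.norm
    refine hmono.trans ?_
    rw [abs_of_nonneg (intervalIntegral.integral_nonneg hab.le fun _ _ => norm_nonneg _)]
    rfl
  | succ j ih =>
    intro hj x hx
    obtain ⟨z, hz, hz0⟩ := exists_zero_of_orthogonal hab hv hb horth (k - (j + 1)) (by omega)
    have h := (hv (k - (j + 1)) (by omega)).sub_eq_integral hz hx
    have hk : k - (j + 1) + 1 = k - j := by omega
    rw [hz0, sub_zero, hk] at h
    rw [h, pow_succ, mul_comm ((b - a) ^ j), mul_assoc, mul_comm (b - a)]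
    have hI : 0 ≤ ∫ x in a..b, |v (k + 1) x| :=
      intervalIntegral.integral_nonneg hab.le fun _ _ => abs_nonneg _
    refine (intervalIntegral.norm_integral_le_of_norm_le_const (f := v (k - j))
      (fun y hy => ih (by omega) y (uIcc_subset_Icc hz hx (uIoc_subset_uIcc hy)))).trans ?_
    refine mul_le_mul_of_nonneg_left ?_ (mul_nonneg (pow_nonneg (by linarith) _) hI)
    rw [abs_le]
    exact ⟨by linarith [hz.1, hz.2, hx.1, hx.2], by linarith [hz.1, hz.2, hx.1, hx.2]⟩

/-- Cauchy-Schwarz, read off from the nonnegativity of the variance of `|f|`. -/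
theorem sq_integral_abs_le (hab : a < b) {f : ℝ → ℝ} (hf : IntervalIntegrable f volume a b)
    (hf2 : IntervalIntegrable (fun x => f x ^ 2) volume a b) :
    (∫ x in a..b, |f x|) ^ 2 ≤ (b - a) * ∫ x in a..b, f x ^ 2 := by
  set I := ∫ x in a..b, |f x| with hI
  have hh : 0 < b - a := sub_pos.2 hab
  have h : 0 ≤ ∫ x in a..b, (|f x| - I / (b - a)) ^ 2 :=
    intervalIntegral.integral_nonneg hab.le fun _ _ => sq_nonneg _
  have e : ∫ x in a..b, (|f x| - I / (b - a)) ^ 2 =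
      (∫ x in a..b, f x ^ 2) - 2 * (I / (b - a)) * I + (b - a) * (I / (b - a)) ^ 2 := by
    have : ∀ x, (|f x| - I / (b - a)) ^ 2 =
        (f x ^ 2 - 2 * (I / (b - a)) * |f x|) + (I / (b - a)) ^ 2 := fun x => by
      rw [← sq_abs (f x)]
      ring
    simp only [this]
    rw [intervalIntegral.integral_add (hf2.sub (hf.abs.const_mul _)) intervalIntegrable_const,
      intervalIntegral.integral_sub hf2 (hf.abs.const_mul _), intervalIntegral.integral_const_mul,
      intervalIntegral.integral_const, smul_eq_mul]
  rw [e] at h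
  have : (∫ x in a..b, f x ^ 2) - 2 * (I / (b - a)) * I + (b - a) * (I / (b - a)) ^ 2 =
      (∫ x in a..b, f x ^ 2) - I ^ 2 / (b - a) := by
    field_simp
    ring
  rw [this, sub_nonneg, div_le_iff₀ hh] at h
  linarith

end Radau

/-! ### The Gauss-Radau projection -/

/-- The polynomial with given coefficients. -/
def polyOf {k : ℕ} (c : Fin (k + 1) → ℝ) : ℝ[X] :=
  ∑ j : Fin (k + 1), Polynomial.C (c j) * Polynomial.X ^ (j : ℕ)

section Projection

variable {k : ℕ}

theorem polyOf_add (c d : Fin (k + 1) → ℝ) : polyOf (c + d) = polyOf c + polyOf d := by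
  simp [polyOf, add_mul, Finset.sum_add_distrib]

theorem polyOf_sub (c d : Fin (k + 1) → ℝ) : polyOf (c - d) = polyOf c - polyOf d := by
  simp [polyOf, sub_mul, Finset.sum_sub_distrib]

theorem polyOf_smul (r : ℝ) (c : Fin (k + 1) → ℝ) :
    polyOf (r • c) = Polynomial.C r * polyOf c := by
  simp [polyOf, Finset.mul_sum, mul_assoc]

theorem natDegree_polyOf (c : Fin (k + 1) → ℝ) : (polyOf c).natDegree ≤ k := by
  refine Polynomial.natDegree_sum_le_of_forall_le _ _ fun j _ => ?_
  exact (Polynomial.natDegree_C_mul_X_pow_le _ _).trans (Nat.lt_succ_iff.1 j.2)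

theorem coeff_polyOf (c : Fin (k + 1) → ℝ) (i : Fin (k + 1)) : (polyOf c).coeff i = c i := by
  simp only [polyOf, Polynomial.finsetSum_coeff, Polynomial.coeff_C_mul_X_pow, Fin.val_inj,
    Finset.sum_ite_eq, Finset.mem_univ, if_true]

theorem eval_polyOf (c : Fin (k + 1) → ℝ) (x : ℝ) :
    (polyOf c).eval x = ∑ j : Fin (k + 1), c j * x ^ (j : ℕ) := by
  simp [polyOf, Polynomial.eval_finsetSum]

theorem orthogonal_of_monomials {a b : ℝ} {f : ℝ → ℝ} (hf : IntervalIntegrable f volume a b)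
    (h : ∀ i < k, ∫ x in a..b, f x * x ^ i = 0) (q : ℝ[X]) (hq : q.natDegree < k) :
    ∫ x in a..b, f x * q.eval x = 0 := by
  have : ∀ x, f x * q.eval x = ∑ i ∈ Finset.range k, q.coeff i * (f x * x ^ i) := fun x => by
    rw [Polynomial.eval_eq_sum_range' hq, Finset.mul_sum]
    exact Finset.sum_congr rfl fun i _ => by ring
  simp only [this]
  rw [intervalIntegral.integral_finsetSum]
  · refine Finset.sum_eq_zero fun i hi => ?_
    rw [intervalIntegral.integral_const_mul, h i (Finset.mem_range.1 hi), mul_zero]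
  · intro i _
    exact (hf.mul_continuousOn (continuous_pow i).continuousOn).const_mul _

/-- The pointwise bound for functions with vanishing moments applies, and the derivative of order `k
+ 1` on its right-hand side is zero. -/
theorem eq_zero_of_orthogonal {a b : ℝ} (hab : a < b) (p : ℝ[X]) (hp : p.natDegree ≤ k)
    (hb : p.eval b = 0)
    (horth : ∀ q : ℝ[X], q.natDegree < k → ∫ x in a..b, p.eval x * q.eval x = 0) : p = 0 := by
  have h := abs_le_of_orthogonal (k := k) (v := fun i x => (Polynomial.derivative^[i] p).eval x) hab
    (fun i _ => by
      simp only [Function.iterate_succ_apply']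
      exact IsPrimitive.poly _) hb horth k le_rfl
  have h0 : Polynomial.derivative^[k + 1] p = 0 :=
    Polynomial.iterate_derivative_eq_zero (by omega)
  simp only [h0, Polynomial.eval_zero, abs_zero, intervalIntegral.integral_zero, mul_zero,
    Nat.sub_self, Function.iterate_zero, id] at h
  refine Polynomial.eq_zero_of_infinite_isRoot p ((Icc_infinite hab).mono fun x hx => ?_)
  exact abs_nonpos_iff.1 (h x hx)

/-- The degrees of freedom of the Gauss-Radau projection on polynomials. -/
def radauMap (k : ℕ) (a b : ℝ) : (Fin (k + 1) → ℝ) →ₗ[ℝ] (Fin (k + 1) → ℝ) where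
  toFun c := fun i => if (i : ℕ) < k then ∫ x in a..b, (polyOf c).eval x * x ^ (i : ℕ)
    else (polyOf c).eval b
  map_add' c d := by
    funext i
    have hi : ∀ p : ℝ[X], IntervalIntegrable (fun x => p.eval x * x ^ (i : ℕ)) volume a b :=
      fun p => (p.continuous.mul (continuous_pow _)).intervalIntegrable _ _
    simp only [polyOf_add, Polynomial.eval_add, Pi.add_apply, add_mul]
    split_ifs
    · exact intervalIntegral.integral_add (hi _) (hi _)
    · rfl
  map_smul' r c := by
    funext i
    simp only [polyOf_smul, Polynomial.eval_mul, Polynomial.eval_C, Pi.smul_apply, smul_eq_mul,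
      RingHom.id_apply, mul_assoc, intervalIntegral.integral_const_mul, mul_ite]

theorem radauMap_injective {a b : ℝ} (hab : a < b) : Function.Injective (radauMap k a b) := by
  rw [injective_iff_map_eq_zero]
  intro c hc
  have hb : (polyOf c).eval b = 0 := by
    have := congrFun hc (Fin.last k)
    simpa [radauMap] using this
  have hm : ∀ i < k, ∫ x in a..b, (polyOf c).eval x * x ^ i = 0 := fun i hi => by
    have := congrFun hc ⟨i, by omega⟩
    simpa [radauMap, hi] using this
  have h0 := eq_zero_of_orthogonal hab (polyOf c) (natDegree_polyOf c) hb
    (orthogonal_of_monomials ((polyOf c).continuous.intervalIntegrable _ _) hm)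
  funext i
  rw [← coeff_polyOf c i, h0, Polynomial.coeff_zero, Pi.zero_apply]

/-- The value at the right end point as a continuous functional on `Hʲ⁺¹(a, b)`. -/
def rightValue (j : ℕ) (a b : ℝ) : Sobolev (j + 1) a b ℝ →L[ℝ] ℝ :=
  (momentL ℝ (Continuous.memLp_Ioo (φ := fun _ => (b - a)⁻¹) (by fun_prop) a b)).comp
    (wdL (j + 1) a b ℝ 0) +
  (momentL ℝ (Continuous.memLp_Ioo (φ := fun x => (b - a)⁻¹ * (x - a)) (by fun_prop) a b)).comp
    (wdL (j + 1) a b ℝ 1)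

theorem IsRep.integral_eq {j : ℕ} {a b : ℝ} {f : Sobolev j a b ℝ} {v : ℕ → ℝ → ℝ}
    (h : IsRep f v) (hab : a ≤ b) (i : Fin (j + 1)) (φ : ℝ → ℝ) :
    ∫ x in Ioo a b, φ x • wd f i x = ∫ x in a..b, φ x * v i x := by
  rw [← integral_Ioo_eq hab]
  refine integral_congr_ae ?_
  filter_upwards [h.ae_eq i] with x hx
  rw [hx, smul_eq_mul]

/-- Integrate the derivative of (x - a)/(b - a) times the function: the weight is 0 at `a` and 1 at
`b`. This writes point evaluation through L² pairings and so makes it continuous. -/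
theorem rightValue_apply {j : ℕ} {a b : ℝ} (hab : a < b) {f : Sobolev (j + 1) a b ℝ}
    {v : ℕ → ℝ → ℝ} (h : IsRep f v) : rightValue j a b f = v 0 b := by
  have h0 := h.isPrimitive 0 (by omega)
  have hh : b - a ≠ 0 := (sub_pos.2 hab).ne'
  have hq : IsPrimitive a b (fun x => (b - a)⁻¹ * (x - a)) (fun _ => (b - a)⁻¹) :=
    IsPrimitive.of_hasDerivAt (fun x => by
      simpa using ((hasDerivAt_id x).sub_const a).const_mul (b - a)⁻¹) continuous_const
  have e := hq.integral_mul_eq h0 hab.le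
  simp only [rightValue, _root_.add_apply, ContinuousLinearMap.comp_apply,
    wdL_apply, momentL_apply, h.integral_eq hab.le]
  simp only [Fin.val_zero, Fin.val_one, zero_add, sub_self, mul_zero, zero_mul, sub_zero,
    inv_mul_cancel₀ hh, one_mul] at e ⊢
  rw [e]
  ring

theorem IsRep.integral_sq_le {j : ℕ} {a b : ℝ} {f : Sobolev j a b ℝ} {v : ℕ → ℝ → ℝ}
    (h : IsRep f v) (hab : a ≤ b) (i : Fin (j + 1)) :
    ∫ x in a..b, v i x ^ 2 ≤ ‖f‖ ^ 2 := by
  have h1 : ∫ x in a..b, v i x ^ 2 = ‖wd f i‖ ^ 2 := by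
    rw [L2.norm_sq_eq, ← integral_Ioo_eq hab]
    refine integral_congr_ae ?_
    filter_upwards [h.ae_eq i] with x hx
    rw [hx, Real.norm_eq_abs, sq_abs]
  rw [h1]
  exact pow_le_pow_left₀ (norm_nonneg _) (Sobolev.norm_wd_le f i) 2

theorem IsRep.intervalIntegrable_sq {j : ℕ} {a b : ℝ} {f : Sobolev j a b ℝ} {v : ℕ → ℝ → ℝ}
    (h : IsRep f v) (hab : a ≤ b) (i : Fin (j + 1)) :
    IntervalIntegrable (fun x => v i x ^ 2) volume a b := by
  rw [intervalIntegrable_iff_integrableOn_Ioo_of_le hab]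
  refine (L2.integrableOn_norm_sq (wd f i)).congr ?_
  filter_upwards [h.ae_eq i] with x hx
  rw [hx, Real.norm_eq_abs, sq_abs]

/-- `c` are the coefficients of the Gauss-Radau projection on `(a, b)` of a function with
(weak) derivatives `v`. -/
structure IsRadau {k : ℕ} (a b : ℝ) (c : Fin (k + 1) → ℝ) (v : ℕ → ℝ → ℝ) : Prop where
  orthogonal : ∀ q : ℝ[X], q.natDegree < k →
    ∫ x in a..b, (v 0 x - (polyOf c).eval x) * q.eval x = 0
  right : v 0 b = (polyOf c).eval b

/-- Existence and continuity of the Gauss-Radau projection. -/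
theorem exists_radau (k : ℕ) {a b : ℝ} (hab : a < b) :
    ∃ G : Sobolev (k + 1) a b ℝ →L[ℝ] (Fin (k + 1) → ℝ),
      ∀ f v, IsRep f v → IsRadau a b (G f) v := by
  -- As many conditions as coefficients: uniqueness already gives existence. Inverting a fixed
  -- linear map also makes the projection a bounded operator.
  let e : (Fin (k + 1) → ℝ) ≃ₗ[ℝ] (Fin (k + 1) → ℝ) :=
    LinearEquiv.ofInjectiveEndo (radauMap k a b) (radauMap_injective hab)
  let D : Sobolev (k + 1) a b ℝ →L[ℝ] (Fin (k + 1) → ℝ) :=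
    ContinuousLinearMap.pi fun i : Fin (k + 1) => if (i : ℕ) < k then
      (momentL ℝ ((continuous_pow (i : ℕ)).memLp_Ioo a b)).comp (wdL (k + 1) a b ℝ 0)
      else rightValue k a b
  refine ⟨(e.symm.toContinuousLinearEquiv : (Fin (k + 1) → ℝ) →L[ℝ] (Fin (k + 1) → ℝ)).comp D,
    fun f v hv => ?_⟩
  set c := ((e.symm.toContinuousLinearEquiv : (Fin (k + 1) → ℝ) →L[ℝ] (Fin (k + 1) → ℝ)).comp D) f
    with hcdef
  have hc : radauMap k a b c = D f := by
    have : e c = D f := e.apply_symm_apply (D f)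
    exact this
  have hv0 := (hv.isPrimitive 0 (by omega)).continuousOn hab.le
  rw [← uIcc_of_le hab.le] at hv0
  have hpc := (polyOf c).continuous
  refine ⟨orthogonal_of_monomials (hv0.intervalIntegrable.sub (hpc.intervalIntegrable _ _))
    fun i hi => ?_, ?_⟩
  · have h1 := congrFun hc ⟨i, by omega⟩
    simp only [radauMap, LinearMap.coe_mk, AddHom.coe_mk, hi, if_true, D,
      ContinuousLinearMap.coe_pi', ContinuousLinearMap.comp_apply, wdL_apply, momentL_apply,
      hv.integral_eq hab.le] at h1
    simp only [sub_mul]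
    have i1 : IntervalIntegrable (fun x => v 0 x * x ^ i) volume a b :=
      (hv0.mul (continuous_pow i).continuousOn).intervalIntegrable
    have i2 : IntervalIntegrable (fun x => (polyOf c).eval x * x ^ i) volume a b :=
      (hpc.mul (continuous_pow i)).intervalIntegrable _ _
    rw [intervalIntegral.integral_sub i1 i2, h1, sub_eq_zero]
    refine intervalIntegral.integral_congr fun x _ => ?_
    simp [mul_comm]
  · have h1 := congrFun hc (Fin.last k)
    simp only [radauMap, LinearMap.coe_mk, AddHom.coe_mk, Fin.val_last, lt_irrefl, if_false, D,
      ContinuousLinearMap.coe_pi'] at h1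
    rw [h1, rightValue_apply hab hv]

variable {a b : ℝ} {f : Sobolev (k + 1) a b ℝ} {v : ℕ → ℝ → ℝ} {c : Fin (k + 1) → ℝ}

/-- The projection has degree at most `k`, so the derivative of order `k + 1` of the projection
error is that of the function itself. In the exponent, `2 * j` comes from the repeated integration
and 1 from Cauchy-Schwarz. -/
theorem IsRadau.sq_le_aux (hab : a < b) (hv : IsRep f v) (hc : IsRadau a b c v) (j : ℕ)
    (hj : j ≤ k) (x : ℝ) (hx : x ∈ Icc a b) :
    (v (k - j) x - (Polynomial.derivative^[k - j] (polyOf c)).eval x) ^ 2 ≤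
      (b - a) ^ (2 * j + 1) * ‖f‖ ^ 2 := by
  have h := abs_le_of_orthogonal (k := k)
    (v := fun i x => v i x - (Polynomial.derivative^[i] (polyOf c)).eval x) hab
    (fun i hi => by
      refine (hv.isPrimitive i hi).sub ?_
      simp only [Function.iterate_succ_apply']
      exact IsPrimitive.poly _) (sub_eq_zero.2 hc.right) hc.orthogonal j hj x hx
  have h0 : Polynomial.derivative^[k + 1] (polyOf c) = 0 :=
    Polynomial.iterate_derivative_eq_zero (Nat.lt_succ_of_le (natDegree_polyOf c))
  simp only [h0, Polynomial.eval_zero, sub_zero] at h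
  have hlast : k + 1 = ((Fin.last (k + 1) : Fin (k + 1 + 1)) : ℕ) := rfl
  have hi := hv.intervalIntegrable_sq hab.le (Fin.last (k + 1))
  have hle := hv.integral_sq_le hab.le (Fin.last (k + 1))
  rw [← hlast] at hi hle
  have h2 := sq_integral_abs_le hab (hv.isPrimitive k (by omega)).integrable hi
  have hh : 0 ≤ b - a := by linarith
  rw [← sq_abs]
  refine (pow_le_pow_left₀ (abs_nonneg _) h 2).trans ?_
  rw [mul_pow, ← pow_mul, pow_succ _ (2 * j), mul_assoc, mul_comm j 2]
  refine mul_le_mul_of_nonneg_left (h2.trans ?_) (pow_nonneg hh _)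
  exact mul_le_mul_of_nonneg_left hle hh

theorem IsRadau.sq_le (hab : a < b) (hv : IsRep f v) (hc : IsRadau a b c v) {x : ℝ}
    (hx : x ∈ Icc a b) :
    (v 0 x - (polyOf c).eval x) ^ 2 ≤ (b - a) ^ (2 * k + 1) * ‖f‖ ^ 2 := by
  simpa using hc.sq_le_aux hab hv k le_rfl x hx

theorem IsRadau.deriv_sq_le (hk : 1 ≤ k) (hab : a < b) (hv : IsRep f v) (hc : IsRadau a b c v)
    {x : ℝ} (hx : x ∈ Icc a b) :
    (v 1 x - (polyOf c).derivative.eval x) ^ 2 ≤ (b - a) ^ (2 * k - 1) * ‖f‖ ^ 2 := by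
  have h := hc.sq_le_aux hab hv (k - 1) (by omega) x hx
  rw [show k - (k - 1) = 1 by omega, show 2 * (k - 1) + 1 = 2 * k - 1 by omega] at h
  simpa using h

end Projection

/-! ### Energy estimate on a single element -/

/-- Contribution of an element `(a, b)` to the hybrid dG method, the boundary data being included in
the hybrid values `ul`, `ur` and `pt` being the time derivative of `p`. -/
def elemForm (a b β ε α : ℝ) (p pt : ℝ[X]) (ul ur : ℝ) (w : ℝ[X]) (ωl ωr : ℝ) : ℝ :=
  (∫ x in a..b, pt.eval x * w.eval x) - β * (∫ x in a..b, p.eval x * w.derivative.eval x)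
  + β * (p.eval b * (w.eval b - ωr) - ul * (w.eval a - ωl))
  + ε * ((∫ x in a..b, p.derivative.eval x * w.derivative.eval x)
    - (p.derivative.eval b * (w.eval b - ωr) - p.derivative.eval a * (w.eval a - ωl))
    + ((p.eval b - ur) * w.derivative.eval b - (p.eval a - ul) * w.derivative.eval a)
    + α / (b - a) * ((p.eval b - ur) * (w.eval b - ωr) + (p.eval a - ul) * (w.eval a - ωl)))

/-- Contribution of an element `(a, b)` to the weak form of the continuous problem, `ut` being the
time derivative and `u₁` the space derivative of `u₀`. -/
def elemExact (a b β ε : ℝ) (ut u₀ u₁ : ℝ → ℝ) (w : ℝ[X]) (ωl ωr : ℝ) : ℝ :=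
  (∫ x in a..b, ut x * w.eval x) - β * (∫ x in a..b, u₀ x * w.derivative.eval x)
  + ε * (∫ x in a..b, u₁ x * w.derivative.eval x)
  + (β * u₀ b - ε * u₁ b) * (w.eval b - ωr) - (β * u₀ a - ε * u₁ a) * (w.eval a - ωl)

section Local

variable {k : ℕ} {a b : ℝ} {f : Sobolev (k + 1) a b ℝ} {v : ℕ → ℝ → ℝ} {c : Fin (k + 1) → ℝ}

theorem IsRep.continuousOn {j : ℕ} {f : Sobolev j a b ℝ} (hab : a ≤ b) (hv : IsRep f v) {i : ℕ}
    (hi : i < j) : ContinuousOn (v i) (Icc a b) := (hv.isPrimitive i hi).continuousOn hab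

theorem IsRadau.integral_sq_le (hab : a < b) (hv : IsRep f v) (hc : IsRadau a b c v) :
    ∫ x in a..b, (v 0 x - (polyOf c).eval x) ^ 2 ≤ (b - a) ^ (2 * k + 2) * ‖f‖ ^ 2 := by
  have hcont : ContinuousOn (fun x => (v 0 x - (polyOf c).eval x) ^ 2) (uIcc a b) := by
    rw [uIcc_of_le hab.le]
    exact ((hv.continuousOn hab.le (by omega)).sub (polyOf c).continuous.continuousOn).pow 2
  refine (intervalIntegral.integral_mono_on hab.le hcont.intervalIntegrable
    intervalIntegrable_const fun x hx => hc.sq_le hab hv hx).trans_eq ?_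
  rw [intervalIntegral.integral_const, smul_eq_mul]
  ring

theorem IsRadau.integral_deriv_sq_le (hk : 1 ≤ k) (hab : a < b) (hv : IsRep f v)
    (hc : IsRadau a b c v) :
    ∫ x in a..b, (v 1 x - (polyOf c).derivative.eval x) ^ 2 ≤ (b - a) ^ (2 * k) * ‖f‖ ^ 2 := by
  have hcont : ContinuousOn (fun x => (v 1 x - (polyOf c).derivative.eval x) ^ 2) (uIcc a b) := by
    rw [uIcc_of_le hab.le]
    exact ((hv.continuousOn hab.le (by omega)).sub
      (polyOf c).derivative.continuous.continuousOn).pow 2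
  refine (intervalIntegral.integral_mono_on hab.le hcont.intervalIntegrable
    intervalIntegrable_const fun x hx => hc.deriv_sq_le hk hab hv hx).trans_eq ?_
  rw [intervalIntegral.integral_const, smul_eq_mul, ← mul_assoc, ← pow_succ',
    show 2 * k - 1 + 1 = 2 * k by omega]

/-- Diffusive part of the energy on one element of size `h`: `zl` and `zr` are the jumps θ - ζ at
the ends, `ηa`, `ηa'`, `ηb'` traces of the projection error and its derivative, and `J`, `K` stand
for ∫θ'² and ∫η'θ'. The stabilization yields complete squares in the jumps; only the traces of η
remain, all controlled by `N`. -/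
theorem energy_algebra {A h α N ηa ηa' ηb' zl zr J K : ℝ} (hα : 0 < α) (hh : 0 < h)
    (hA : A = α / h) (h1 : h * ηa' ^ 2 ≤ N) (h2 : h * ηb' ^ 2 ≤ N) (h3 : ηa ^ 2 ≤ h * N)
    (hJ : - N ≤ J - 2 * K) :
    - ((1 + 1 / α + α) * N) ≤
      J - 2 * K + ηb' * zr - ηa' * zl + A * (zr * zr + (zl - ηa) * zl) := by
  have hN : 0 ≤ N := le_trans (by positivity) h1
  have e : J - 2 * K + ηb' * zr - ηa' * zl + A * (zr * zr + (zl - ηa) * zl) =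
      J - 2 * K + A * (zr + h / (2 * α) * ηb') ^ 2 + A / 2 * (zl - h / α * ηa') ^ 2
        + A / 2 * (zl - ηa) ^ 2 - (h * ηb' ^ 2) / (4 * α) - (h * ηa' ^ 2) / (2 * α)
        - α / 2 * (ηa ^ 2 / h) := by
    subst hA
    field_simp
    ring
  have hA0 : 0 < A := hA ▸ div_pos hα hh
  have b1 : (h * ηb' ^ 2) / (4 * α) ≤ N / (4 * α) := by gcongr
  have b2 : (h * ηa' ^ 2) / (2 * α) ≤ N / (2 * α) := by gcongr
  have b3 : α / 2 * (ηa ^ 2 / h) ≤ α / 2 * N := by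
    gcongr
    rw [div_le_iff₀ hh]
    linarith
  have p1 : 0 ≤ A * (zr + h / (2 * α) * ηb') ^ 2 := by positivity
  have p2 : 0 ≤ A / 2 * (zl - h / α * ηa') ^ 2 := by positivity
  have p3 : 0 ≤ A / 2 * (zl - ηa) ^ 2 := by positivity
  -- The three remainders add up to 3N/(4α) + αN/2; the last two summands are the slack up to (1/α +
  -- α)N.
  have s : N / (4 * α) + N / (2 * α) + α / 2 * N + 1 / 4 * (N / α) + α / 2 * N
      = (1 / α + α) * N := by
    field_simp
    ring
  have p4 : 0 ≤ N / α := by positivity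
  have p5 : 0 ≤ α * N := by positivity
  rw [e]
  linarith

/-- Local coercivity at θ = `polyOf (p - c)` with hybrid test values equal to the nodal errors. The
convective terms give two nonnegative squares of jumps and the nodal difference on the left-hand
side, which is left to telescope over the mesh. -/
theorem elemForm_sub_elemExact_ge (hk : 1 ≤ k) (hab : a < b) (hv : IsRep f v)
    (hc : IsRadau a b c v) {f' : Sobolev (k + 1) a b ℝ} {v' : ℕ → ℝ → ℝ} {c' : Fin (k + 1) → ℝ}
    (hv' : IsRep f' v') (hc' : IsRadau a b c' v') {α β ε τ : ℝ} (hα : 0 < α) (hβ : 0 ≤ β)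
    (hε : 0 ≤ ε) (hτ : 0 < τ) (p pt : Fin (k + 1) → ℝ) (ul ur : ℝ) :
    (∫ x in a..b, (polyOf (p - c)).eval x * (polyOf (pt - c')).eval x)
      - τ * ((b - a) ^ (2 * k + 2) * ‖f'‖ ^ 2)
      - 1 / (4 * τ) * (∫ x in a..b, (polyOf (p - c)).eval x * (polyOf (p - c)).eval x)
      - ε * ((1 + 1 / α + α) * ((b - a) ^ (2 * k) * ‖f‖ ^ 2))
      - β / 2 * ((ur - v 0 b) ^ 2 - (ul - v 0 a) ^ 2) ≤
    elemForm a b β ε α (polyOf p) (polyOf pt) ul ur (polyOf (p - c)) (ul - v 0 a) (ur - v 0 b)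
      - elemExact a b β ε (v' 0) (v 0) (v 1) (polyOf (p - c)) (ul - v 0 a) (ur - v 0 b) := by
  set θ := polyOf (p - c) with hθ
  have hp : polyOf p = θ + polyOf c := by rw [hθ, polyOf_sub, sub_add_cancel]
  have hpt : polyOf pt = polyOf (pt - c') + polyOf c' := by rw [polyOf_sub, sub_add_cancel]
  set φ := polyOf (pt - c') with hφ
  set q := polyOf c with hq
  set q' := polyOf c' with hq'
  rw [hp, hpt]
  have hh : 0 < b - a := sub_pos.2 hab
  have ha' : a ∈ Icc a b := ⟨le_rfl, hab.le⟩
  have hb' : b ∈ Icc a b := ⟨hab.le, le_rfl⟩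
  have hθd : θ.natDegree ≤ k := natDegree_polyOf _
  have hd1 : θ.derivative.natDegree < k :=
    (Polynomial.natDegree_derivative_le θ).trans_lt (by omega)
  have hd2 : θ.derivative.derivative.natDegree < k :=
    (Polynomial.natDegree_derivative_le _).trans_lt (by omega)
  have c0 : ContinuousOn (v 0) (uIcc a b) := by
    rw [uIcc_of_le hab.le]; exact hv.continuousOn hab.le (by omega)
  have c1 : ContinuousOn (v 1) (uIcc a b) := by
    rw [uIcc_of_le hab.le]; exact hv.continuousOn hab.le (by omega)
  have c0' : ContinuousOn (v' 0) (uIcc a b) := by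
    rw [uIcc_of_le hab.le]; exact hv'.continuousOn hab.le (by omega)
  have cp : ∀ r : ℝ[X], ContinuousOn (fun x => r.eval x) (uIcc a b) :=
    fun r => r.continuous.continuousOn
  have cs : ∀ r : ℝ[X], ContinuousOn (fun x => v 1 x - r.eval x) (uIcc a b) :=
    fun r => c1.sub (cp r)
  have cs' : ∀ r : ℝ[X], ContinuousOn (fun x => v' 0 x - r.eval x) (uIcc a b) :=
    fun r => c0'.sub (cp r)
  have ii : ∀ {g₁ g₂ : ℝ → ℝ}, ContinuousOn g₁ (uIcc a b) → ContinuousOn g₂ (uIcc a b) →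
      IntervalIntegrable (fun x => g₁ x * g₂ x) volume a b :=
    fun h1 h2 => (h1.mul h2).intervalIntegrable
  have o1 : ∫ x in a..b, v 0 x * θ.derivative.eval x =
      ∫ x in a..b, q.eval x * θ.derivative.eval x := by
    have := hc.orthogonal _ hd1
    simp only [sub_mul] at this
    rwa [intervalIntegral.integral_sub (ii c0 (cp _)) (ii (cp _) (cp _)), sub_eq_zero] at this
  have hη : IsPrimitive a b (fun x => v 0 x - q.eval x) (fun x => v 1 x - q.derivative.eval x) :=
    (hv.isPrimitive 0 (by omega)).sub (IsPrimitive.poly q)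
  have hηb : v 0 b - q.eval b = 0 := sub_eq_zero.2 hc.right
  -- η vanishes at `b` and is orthogonal to θ''. Hence the trace term η(a)θ'(a) contributes a second
  -- copy of -∫η'θ', whence the factor 2 in the bound `b2`.
  have o2 : ∫ x in a..b, (v 1 x - q.derivative.eval x) * θ.derivative.eval x =
      - ((v 0 a - q.eval a) * θ.derivative.eval a) := by
    rw [hη.integral_mul_eq (IsPrimitive.poly _) hab.le, hc.orthogonal _ hd2, hηb]
    ring
  have o3 : ∫ x in a..b, θ.eval x * θ.derivative.eval x = (θ.eval b ^ 2 - θ.eval a ^ 2) / 2 := by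
    have := (IsPrimitive.poly θ).integral_mul_eq (IsPrimitive.poly θ) hab.le
    have e : ∫ x in a..b, θ.derivative.eval x * θ.eval x =
        ∫ x in a..b, θ.eval x * θ.derivative.eval x := by
      simp only [mul_comm]
    rw [e] at this
    linarith
  have s1 : ∫ x in a..b, (φ + q').eval x * θ.eval x =
      (∫ x in a..b, θ.eval x * φ.eval x) + ∫ x in a..b, q'.eval x * θ.eval x := by
    rw [← intervalIntegral.integral_add (ii (cp _) (cp _)) (ii (cp _) (cp _))]
    refine intervalIntegral.integral_congr fun x _ => ?_
    simp only [Polynomial.eval_add]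
    ring
  have s2 : ∫ x in a..b, (θ + q).eval x * θ.derivative.eval x =
      (∫ x in a..b, θ.eval x * θ.derivative.eval x)
        + ∫ x in a..b, q.eval x * θ.derivative.eval x := by
    rw [← intervalIntegral.integral_add (ii (cp _) (cp _)) (ii (cp _) (cp _))]
    refine intervalIntegral.integral_congr fun x _ => ?_
    simp only [Polynomial.eval_add]
    ring
  have s3 : ∫ x in a..b, (θ + q).derivative.eval x * θ.derivative.eval x =
      (∫ x in a..b, θ.derivative.eval x * θ.derivative.eval x)
        + ∫ x in a..b, q.derivative.eval x * θ.derivative.eval x := by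
    rw [← intervalIntegral.integral_add (ii (cp _) (cp _)) (ii (cp _) (cp _))]
    refine intervalIntegral.integral_congr fun x _ => ?_
    simp only [Polynomial.derivative_add, Polynomial.eval_add]
    ring
  have s4 : ∫ x in a..b, v 1 x * θ.derivative.eval x =
      (∫ x in a..b, (v 1 x - q.derivative.eval x) * θ.derivative.eval x)
        + ∫ x in a..b, q.derivative.eval x * θ.derivative.eval x := by
    rw [← intervalIntegral.integral_add (ii (cs _) (cp _)) (ii (cp _) (cp _))]
    refine intervalIntegral.integral_congr fun x _ => ?_
    ring
  have s5 : ∫ x in a..b, v' 0 x * θ.eval x =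
      (∫ x in a..b, (v' 0 x - q'.eval x) * θ.eval x) + ∫ x in a..b, q'.eval x * θ.eval x := by
    rw [← intervalIntegral.integral_add (ii (cs' _) (cp _)) (ii (cp _) (cp _))]
    refine intervalIntegral.integral_congr fun x _ => ?_
    ring
  -- Young's inequality; the free parameter τ is tied later to the length of the time interval.
  have b1 : ∫ x in a..b, (v' 0 x - q'.eval x) * θ.eval x ≤
      τ * ((b - a) ^ (2 * k + 2) * ‖f'‖ ^ 2)
        + 1 / (4 * τ) * ∫ x in a..b, θ.eval x * θ.eval x := by
    have i1 : IntervalIntegrable (fun x => (v' 0 x - q'.eval x) ^ 2) volume a b :=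
      ((cs' _).pow 2).intervalIntegrable
    have h1 := hc'.integral_sq_le hab hv'
    have h2 : ∫ x in a..b, (v' 0 x - q'.eval x) * θ.eval x ≤
        ∫ x in a..b, (τ * (v' 0 x - q'.eval x) ^ 2 + 1 / (4 * τ) * (θ.eval x * θ.eval x)) := by
      refine intervalIntegral.integral_mono_on hab.le (ii (cs' _) (cp _))
        ((i1.const_mul _).add ((ii (cp _) (cp _)).const_mul _)) fun x _ => ?_
      have : τ * (v' 0 x - q'.eval x) ^ 2 + 1 / (4 * τ) * (θ.eval x * θ.eval x)
          - (v' 0 x - q'.eval x) * θ.eval x =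
          τ * ((v' 0 x - q'.eval x) - θ.eval x / (2 * τ)) ^ 2 := by
        field_simp
        ring
      have h0 : 0 ≤ τ * ((v' 0 x - q'.eval x) - θ.eval x / (2 * τ)) ^ 2 := by positivity
      linarith
    refine h2.trans ?_
    rw [intervalIntegral.integral_add (i1.const_mul _) ((ii (cp _) (cp _)).const_mul _),
      intervalIntegral.integral_const_mul, intervalIntegral.integral_const_mul]
    have := mul_le_mul_of_nonneg_left h1 hτ.le
    linarith
  set N := (b - a) ^ (2 * k) * ‖f‖ ^ 2 with hN
  have b2 : - N ≤ (∫ x in a..b, θ.derivative.eval x * θ.derivative.eval x)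
      - 2 * ∫ x in a..b, (v 1 x - q.derivative.eval x) * θ.derivative.eval x := by
    have i1 : IntervalIntegrable (fun x => (v 1 x - q.derivative.eval x) ^ 2) volume a b :=
      ((cs _).pow 2).intervalIntegrable
    have h1 := hc.integral_deriv_sq_le hk hab hv
    have h2 : 0 ≤ ∫ x in a..b, (θ.derivative.eval x * θ.derivative.eval x
        - 2 * ((v 1 x - q.derivative.eval x) * θ.derivative.eval x)
        + (v 1 x - q.derivative.eval x) ^ 2) := by
      refine intervalIntegral.integral_nonneg hab.le fun x _ => ?_
      nlinarith [sq_nonneg (θ.derivative.eval x - (v 1 x - q.derivative.eval x))]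
    rw [intervalIntegral.integral_add
        ((ii (cp _) (cp _)).sub ((ii (cs _) (cp _)).const_mul 2)) i1,
      intervalIntegral.integral_sub (ii (cp _) (cp _)) ((ii (cs _) (cp _)).const_mul 2),
      intervalIntegral.integral_const_mul] at h2
    linarith
  have hpow : (b - a) * (b - a) ^ (2 * k - 1) = (b - a) ^ (2 * k) := by
    rw [← pow_succ', show 2 * k - 1 + 1 = 2 * k by omega]
  have b3 : ∀ x ∈ Icc a b, (b - a) * (v 1 x - q.derivative.eval x) ^ 2 ≤ N := fun x hx => by
    have := mul_le_mul_of_nonneg_left (hc.deriv_sq_le hk hab hv hx) hh.le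
    rwa [← mul_assoc, hpow] at this
  have b4 : (v 0 a - q.eval a) ^ 2 ≤ (b - a) * N := by
    refine (hc.sq_le hab hv ha').trans_eq ?_
    rw [hN]
    ring
  have key := energy_algebra (zl := θ.eval a - (ul - v 0 a)) (zr := θ.eval b - (ur - v 0 b))
    hα hh rfl (b3 a ha') (b3 b hb') b4 b2
  have key' := mul_le_mul_of_nonneg_left key hε
  -- The upwind dissipation: these squares complete -∫θθ' and the flux terms up to ζ_r² and ζ_l².
  have b5 : 0 ≤ β / 2 * ((θ.eval b - (ur - v 0 b)) ^ 2 + (θ.eval a - (ul - v 0 a)) ^ 2) := by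
    positivity
  have hvb : v 0 b = q.eval b := hc.right
  unfold elemForm elemExact
  rw [s1, s2, s3, s4, s5, o1, o3]
  rw [o2] at key' ⊢
  simp only [Polynomial.derivative_add, Polynomial.eval_add]
  rw [hvb] at key' b5 ⊢
  linear_combination b1 + key' + b5

end Local

/-! ### Restriction to an element and time regularity -/

theorem memLp_indicator {φ : ℝ → ℝ} (hφ : Continuous φ) (a b l : ℝ) :
    MemLp ((Ioo a b).indicator φ) 2 (volume.restrict (Ioo 0 l)) :=
  (hφ.memLp_Ioo 0 l).indicator measurableSet_Ioo

theorem momentL_indicator {φ : ℝ → ℝ} (hφ : Continuous φ) {a b l : ℝ} (ha : 0 ≤ a) (hb : b ≤ l)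
    (f : L2 0 l ℝ) :
    momentL ℝ (memLp_indicator hφ a b l) f = ∫ x in Ioo a b, φ x * f x := by
  rw [momentL_apply]
  have e : ∀ x, (Ioo a b).indicator φ x • f x = (Ioo a b).indicator (fun x => φ x * f x) x := by
    intro x
    by_cases hx : x ∈ Ioo a b
    · simp [hx]
    · simp [hx]
  simp only [e]
  rw [setIntegral_indicator measurableSet_Ioo, inter_eq_self_of_subset_right]
  exact Ioo_subset_Ioo ha hb

theorem ae_eq_of_forall_isTest {a b l : ℝ} (ha : 0 ≤ a) (hb : b ≤ l) {f : L2 a b ℝ} {g : L2 0 l ℝ}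
    (h : ∀ φ, IsTest a b φ → ∫ x in Ioo a b, φ x * f x = ∫ x in Ioo a b, φ x * g x) :
    f =ᵐ[volume.restrict (Ioo a b)] g := by
  have hf := L2.integrableOn f
  have hg := (L2.integrableOn g).mono_set (Ioo_subset_Ioo ha hb)
  have h0 : ∀ᵐ x ∂(volume.restrict (Ioo a b)), f x - g x = 0 := by
    refine ae_eq_zero_of_forall_isTest (hf.sub hg) fun φ hφ => ?_
    have hφm := hφ.1.continuous
    have hbd : ∃ C, ∀ x, ‖φ x‖ ≤ C := hφ.2.1.exists_bound_of_continuous hφm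
    obtain ⟨C, hC⟩ := hbd
    have i1 : IntegrableOn (fun x => φ x * f x) (Ioo a b) :=
      hf.bdd_mul hφm.aestronglyMeasurable (Filter.Eventually.of_forall hC)
    have i2 : IntegrableOn (fun x => φ x * g x) (Ioo a b) :=
      hg.bdd_mul hφm.aestronglyMeasurable (Filter.Eventually.of_forall hC)
    simp only [smul_eq_mul, mul_sub]
    rw [integral_sub i1 i2, h φ hφ, sub_self]
  filter_upwards [h0] with x hx
  exact sub_eq_zero.1 hx

section Time

variable {k : ℕ} {tmax a b l : ℝ} {u : ℝ → L2 0 l ℝ}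
  {U : Sobolev 1 0 tmax (Sobolev k a b ℝ)}

/-- The primitive in time, vanishing at `t = 0`, of the weak time derivative. -/
def timePrim {X : Type*} [NormedAddCommGroup X] [NormedSpace ℝ X] [CompleteSpace X]
    (U : Sobolev 1 0 tmax X) (t : ℝ) : X := ∫ s in (0 : ℝ)..t, wd U 1 s

theorem timePrim_isPrimitive {X : Type*} [NormedAddCommGroup X] [NormedSpace ℝ X]
    [CompleteSpace X] (U : Sobolev 1 0 tmax X) (ht : 0 < tmax) :
    IsPrimitive 0 tmax (timePrim U) (wd U 1) := by
  have := L2.isPrimitive (wd U 1) ht.le 0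
  simp only [zero_add] at this
  exact this

theorem norm_timePrim_sq_le {X : Type*} [NormedAddCommGroup X] [NormedSpace ℝ X]
    [CompleteSpace X] (U : Sobolev 1 0 tmax X) (htm : 0 < tmax) {t : ℝ} (ht : t ∈ Icc 0 tmax) :
    ‖timePrim U t‖ ^ 2 ≤ tmax * ‖U‖ ^ 2 := by
  have h1 : ‖timePrim U t‖ ≤ ∫ s in (0 : ℝ)..tmax, |‖wd U 1 s‖| := by
    simp only [abs_norm]
    refine (intervalIntegral.norm_integral_le_integral_norm ht.1).trans ?_
    refine intervalIntegral.integral_mono_interval le_rfl ht.1 ht.2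
      (Filter.Eventually.of_forall fun _ => norm_nonneg _) ?_
    exact (L2.intervalIntegrable (wd U 1) htm.le).norm
  have h2 := sq_integral_abs_le htm (L2.intervalIntegrable (wd U 1) htm.le).norm
    ((intervalIntegrable_iff_integrableOn_Ioo_of_le htm.le).2 (L2.integrableOn_norm_sq (wd U 1)))
  rw [← integral_Ioo_eq htm.le (fun s => ‖wd U 1 s‖ ^ 2), ← L2.norm_sq_eq, sub_zero] at h2
  refine (pow_le_pow_left₀ (norm_nonneg _) h1 2).trans (h2.trans ?_)
  gcongr
  exact Sobolev.norm_wd_le U 1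

theorem eqOn_Icc_of_ae_Ioo {f g : ℝ → ℝ} {c d : ℝ} (hcd : c < d)
    (h : ∀ᵐ t ∂(volume.restrict (Ioo c d)), f t = g t) (hf : ContinuousOn f (Icc c d))
    (hg : ContinuousOn g (Icc c d)) : EqOn f g (Icc c d) := by
  refine Measure.eqOn_Icc_of_ae_eq (μ := volume) hcd.ne ?_ hf hg
  rw [← restrict_Ioo_eq_restrict_Icc]
  exact h

theorem momentL_apply_real (f : L2 a b ℝ) {φ : ℝ → ℝ}
    (hφ : MemLp φ 2 (volume.restrict (Ioo a b))) :
    momentL ℝ hφ f = ∫ x in Ioo a b, φ x * f x := by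
  rw [momentL_apply]
  rfl

/-- Pair `U` and `u` with a test function in space: both sides are continuous in time and agree for
almost every time, hence always. This upgrades the almost-everywhere representation by `U` to every
`t`. -/
theorem timePrim_spec (htm : 0 < tmax) (ha : 0 ≤ a) (hb : b ≤ l)
    (hu : ContinuousOn u (Icc 0 tmax)) (hu0 : u 0 = 0)
    (hU : ∀ᵐ t ∂(volume.restrict (Ioo 0 tmax)), ∀ᵐ x ∂(volume.restrict (Ioo a b)),
      wd (wd U 0 t) 0 x = u t x) :
    (∀ t ∈ Icc 0 tmax, wd (timePrim U t) 0 =ᵐ[volume.restrict (Ioo a b)] u t) ∧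
      ∀ᵐ t ∂(volume.restrict (Ioo 0 tmax)), wd U 0 t = timePrim U t := by
  obtain ⟨c, hc⟩ := (Sobolev.isWeakDeriv U 1).exists_ae_eq htm
  have hprim := timePrim_isPrimitive U htm
  have hVc := hprim.continuousOn htm.le
  have key : ∀ t ∈ Icc 0 tmax, wd (c + timePrim U t) 0 =ᵐ[volume.restrict (Ioo a b)] u t := by
    intro t ht
    refine ae_eq_of_forall_isTest ha hb fun φ hφ => ?_
    have hφc := hφ.1.continuous
    have hEq : EqOn (fun t => momentL ℝ (hφc.memLp_Ioo a b) (wdL k a b ℝ 0 (c + timePrim U t)))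
        (fun t => momentL ℝ (memLp_indicator hφc a b l) (u t)) (Icc 0 tmax) := by
      refine eqOn_Icc_of_ae_Ioo htm ?_ ?_ ?_
      · filter_upwards [hc, hU] with t h1 h2
        have h1' : wd U 0 t = c + timePrim U t := h1
        rw [wdL_apply, momentL_apply_real, momentL_indicator hφc ha hb, ← h1']
        refine integral_congr_ae ?_
        filter_upwards [h2] with x hx
        rw [hx]
      · exact (ContinuousLinearMap.continuous _).comp_continuousOn
          ((ContinuousLinearMap.continuous _).comp_continuousOn (continuousOn_const.add hVc))
      · exact (ContinuousLinearMap.continuous _).comp_continuousOn hu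
    have := hEq ht
    simpa only [wdL_apply, momentL_apply_real, momentL_indicator hφc ha hb] using this
  -- At `t = 0` the primitive vanishes and so does `u`, which fixes the integration constant.
  have hc0 : c = 0 := by
    refine Sobolev.ext (Lp.ext ?_)
    have h0 := key 0 ⟨le_rfl, htm.le⟩
    have e0 : timePrim U 0 = 0 := intervalIntegral.integral_same
    rw [e0, add_zero, hu0] at h0
    have e1 : (0 : L2 0 l ℝ) =ᵐ[volume.restrict (Ioo a b)] fun _ => (0 : ℝ) :=
      ae_mono (Measure.restrict_mono (Ioo_subset_Ioo ha hb) le_rfl)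
        (Lp.coeFn_zero ℝ 2 (volume.restrict (Ioo 0 l)))
    exact (h0.trans e1).trans (Lp.coeFn_zero ℝ 2 (volume.restrict (Ioo a b))).symm
  subst hc0
  simp only [zero_add] at key
  refine ⟨key, ?_⟩
  filter_upwards [hc] with t h1
  rw [h1, zero_add]
  rfl

/-- At almost every time the Bochner primitive is differentiable with derivative `wd U 1 t`, and a
bounded spatial moment may be differentiated. The exceptional times do not depend on φ, so φ may
later be the discrete error at time `t`. -/
theorem ae_integral_timeDeriv (htm : 0 < tmax) (ha : 0 ≤ a) (hb : b ≤ l)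
    (hu : ContDiffOn ℝ 1 u (Icc 0 tmax))
    (hV : ∀ t ∈ Icc 0 tmax, wd (timePrim U t) 0 =ᵐ[volume.restrict (Ioo a b)] u t) :
    ∀ᵐ t ∂(volume.restrict (Ioo 0 tmax)), ∀ φ : ℝ → ℝ, Continuous φ →
      ∫ x in Ioo a b, φ x * derivWithin u (Icc 0 tmax) t x =
        ∫ x in Ioo a b, φ x * wd (wd U 1 t) 0 x := by
  have h1 := (timePrim_isPrimitive U htm).integrable.ae_hasDerivAt_integral
  rw [ae_restrict_iff' measurableSet_Ioo]
  filter_upwards [h1] with t h1 ht φ hφ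
  have htI : t ∈ Icc 0 tmax := Ioo_subset_Icc_self ht
  have hV' : HasDerivAt (timePrim U) (wd U 1 t) t :=
    h1 (by rwa [uIcc_of_le htm.le]) 0 left_mem_uIcc
  have hnhds : Icc 0 tmax ∈ nhds t := Icc_mem_nhds ht.1 ht.2
  have hu' : HasDerivAt u (derivWithin u (Icc 0 tmax) t) t :=
    ((hu.differentiableOn (by norm_num) t htI).hasDerivWithinAt).hasDerivAt hnhds
  have d1 := (((momentL ℝ (hφ.memLp_Ioo a b)).comp (wdL k a b ℝ 0)).hasFDerivAt.comp_hasDerivAt t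
    hV')
  have d2 := ((momentL ℝ (memLp_indicator hφ a b l)).hasFDerivAt.comp_hasDerivAt t hu')
  have hee : (((momentL ℝ (hφ.memLp_Ioo a b)).comp (wdL k a b ℝ 0)) ∘ timePrim U) =ᶠ[nhds t]
      (momentL ℝ (memLp_indicator hφ a b l)) ∘ u := by
    filter_upwards [hnhds] with s hs
    simp only [Function.comp_apply, ContinuousLinearMap.comp_apply, wdL_apply,
      momentL_apply_real, momentL_indicator hφ ha hb]
    refine integral_congr_ae ?_
    filter_upwards [hV s hs] with x hx
    rw [hx]
  have := (d2.congr_of_eventuallyEq hee).unique d1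
  simpa only [ContinuousLinearMap.comp_apply, wdL_apply,
      momentL_apply_real, momentL_indicator hφ ha hb] using this

end Time

theorem isPrimitive_derivWithin {X : Type*} [NormedAddCommGroup X] [NormedSpace ℝ X]
    [CompleteSpace X] {f : ℝ → X} {c d : ℝ} (hcd : c < d) (hf : ContDiffOn ℝ 1 f (Icc c d)) :
    IsPrimitive c d f (derivWithin f (Icc c d)) := by
  have hc : ContinuousOn (derivWithin f (Icc c d)) (Icc c d) :=
    hf.continuousOn_derivWithin (uniqueDiffOn_Icc hcd) le_rfl
  refine ⟨ContinuousOn.intervalIntegrable (by rwa [uIcc_of_le hcd.le]), fun x hx => ?_⟩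
  have hsub : Icc c x ⊆ Icc c d := Icc_subset_Icc_right hx.2
  rw [intervalIntegral.integral_eq_sub_of_hasDerivAt_of_le hx.1 (hf.continuousOn.mono hsub)
    (fun y hy => ?_) (ContinuousOn.intervalIntegrable (by
      rw [uIcc_of_le hx.1]
      exact hc.mono hsub))]
  · abel
  · have hy' := hsub (Ioo_subset_Icc_self hy)
    exact (hf.differentiableOn (by norm_num) y hy').hasDerivWithinAt.hasDerivAt
      (Icc_mem_nhds hy.1 (hy.2.trans_le hx.2))

/-! ### Agreement of representatives -/

theorem IsPrimitive.eqOn_deriv {a b : ℝ} (hab : a < b) {f f' g g' : ℝ → ℝ}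
    (hf : IsPrimitive a b f f') (hg : IsPrimitive a b g g') (h : EqOn f g (Icc a b))
    (hf' : ContinuousOn f' (Icc a b)) (hg' : ContinuousOn g' (Icc a b)) :
    EqOn f' g' (Icc a b) := by
  have hd : ∀ {F F' : ℝ → ℝ}, IsPrimitive a b F F' → ContinuousOn F' (Icc a b) → ∀ x ∈ Ioo a b,
      HasDerivAt F (F' x) x := by
    intro F F' hF hF' x hx
    have hn := Icc_mem_nhds hx.1 hx.2
    have h1 : HasDerivAt (fun y => F a + ∫ z in a..y, F' z) (F' x) x := by
      refine (intervalIntegral.integral_hasDerivAt_right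
        (hF.intervalIntegrable_sub ⟨le_rfl, hab.le⟩ (Ioo_subset_Icc_self hx)) ?_
        (hF'.continuousAt hn)).const_add _
      have hm := hF'.stronglyMeasurableAtFilter_nhdsWithin (μ := volume) measurableSet_Icc x
      rwa [nhdsWithin_eq_nhds.2 hn] at hm
    refine h1.congr_of_eventuallyEq ?_
    filter_upwards [hn] with y hy
    exact hF.eq_add_integral y hy
  have hI : EqOn f' g' (Ioo a b) := fun x hx => by
    refine (hd hf hf' x hx).unique ((hd hg hg' x hx).congr_of_eventuallyEq ?_)
    filter_upwards [Icc_mem_nhds hx.1 hx.2] with y hy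
    exact h hy
  exact eqOn_Icc_of_ae_Ioo hab ((ae_restrict_iff' measurableSet_Ioo).2
    (Filter.Eventually.of_forall fun x hx => hI hx)) hf' hg'

/-- Continuous representatives that agree almost everywhere agree on the closed interval, so the
choice inside `ptVal` is immaterial. -/
theorem ptVal_eq {a b : ℝ} (hab : a < b) {f : L2 a b ℝ} {g : ℝ → ℝ}
    (hg : ContinuousOn g (Icc a b)) (h : f =ᵐ[volume.restrict (Ioo a b)] g) {x : ℝ}
    (hx : x ∈ Icc a b) : ptVal f x = g x := by
  have hex : ∃ g : ℝ → ℝ, ContinuousOn g (Icc a b) ∧ f =ᵐ[volume.restrict (Ioo a b)] g := ⟨g, hg, h⟩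
  unfold ptVal
  rw [dif_pos hex]
  exact eqOn_Icc_of_ae_Ioo hab (hex.choose_spec.2.symm.trans h) hex.choose_spec.1 hg hx

theorem IsRep.ptVal_eq {j : ℕ} {a b : ℝ} (hab : a < b) {f : Sobolev j a b ℝ} {v : ℕ → ℝ → ℝ}
    (hv : IsRep f v) {i : Fin (j + 1)} (hi : (i : ℕ) < j) {x : ℝ} (hx : x ∈ Icc a b) :
    ptVal (wd f i) x = v i x :=
  HybridDG.ptVal_eq hab (hv.continuousOn hab.le hi) (hv.ae_eq i) hx

/-- The representatives of a function on an edge and of its restriction to an element agree. -/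
theorem IsRep.eqOn_sub {j j' : ℕ} {a b l : ℝ} (hab : a < b) (ha : 0 ≤ a) (hb : b ≤ l)
    {f : Sobolev j a b ℝ} {g : Sobolev j' 0 l ℝ} {v y : ℕ → ℝ → ℝ} (hj : 2 ≤ j) (hj' : 2 ≤ j')
    (hv : IsRep f v) (hy : IsRep g y) (h : wd f 0 =ᵐ[volume.restrict (Ioo a b)] wd g 0) :
    EqOn (v 0) (y 0) (Icc a b) ∧ EqOn (v 1) (y 1) (Icc a b) := by
  have hl : 0 ≤ l := ha.trans (hab.le.trans hb)
  have hsub : Icc a b ⊆ Icc 0 l := Icc_subset_Icc ha hb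
  have h0 : EqOn (v 0) (y 0) (Icc a b) := by
    refine eqOn_Icc_of_ae_Ioo hab ?_ (hv.continuousOn hab.le (by omega))
      ((hy.continuousOn hl (by omega)).mono hsub)
    have h2 := ae_mono (Measure.restrict_mono (Ioo_subset_Ioo ha hb) le_rfl) (hy.ae_eq 0)
    filter_upwards [hv.ae_eq 0, h2, h] with x e1 e2 e3
    exact e1.symm.trans (e3.trans e2)
  refine ⟨h0, ?_⟩
  exact (hv.isPrimitive 0 (by omega)).eqOn_deriv hab
    ((hy.isPrimitive 0 (by omega)).mono (hsub ⟨le_rfl, hab.le⟩) (hsub ⟨hab.le, le_rfl⟩)) h0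
    (hv.continuousOn hab.le (by omega)) ((hy.continuousOn hl (by omega)).mono hsub)

/-! ### Vertex balances and sums over elements -/

namespace Network

variable {V E : Type*} {N : Network V E}

theorem n_src (e : E) : N.n e (N.src e) = -1 := by simp [n]

theorem n_tgt (e : E) : N.n e (N.tgt e) = 1 := by simp [n, (N.src_ne_tgt e).symm]

theorem coord_src (e : E) : N.coord e (N.src e) = 0 := by simp [coord]

theorem coord_tgt (e : E) : N.coord e (N.tgt e) = N.len e := by
  simp [coord, (N.src_ne_tgt e).symm]

theorem incident_src (e : E) : N.Incident e (N.src e) := Or.inl rfl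

theorem incident_tgt (e : E) : N.Incident e (N.tgt e) := Or.inr rfl

/-- A boundary vertex has a single edge, so that edge is `e`, which leads out of its source. -/
theorem isInflow_src_iff (e : E) : N.IsInflow (N.src e) ↔ N.IsBoundary (N.src e) := by
  refine ⟨fun h => h.1, fun h => ⟨h, fun e' he' => ?_⟩⟩
  obtain ⟨e₀, he₀⟩ := ncard_eq_one.1 h
  have h1 : e' ∈ ({e₀} : Set E) := he₀ ▸ he'
  have h2 : e ∈ ({e₀} : Set E) := he₀ ▸ N.incident_src e
  rw [mem_singleton_iff] at h1 h2
  rw [h1, ← h2, n_src]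
  norm_num

theorem not_isInflow_tgt (e : E) : ¬ N.IsInflow (N.tgt e) := fun h => by
  have := h.2 e (N.incident_tgt e)
  rw [n_tgt] at this
  linarith

open Classical in
-- Exchange the sums over vertices and edges: since there are no loops, each edge contributes at
-- exactly two distinct vertices.
theorem sum_flux_eq_zero [Fintype V] [Fintype E] (q : E → V → ℝ) (ζ : V → ℝ)
    (hζ : ∀ v, N.IsBoundary v → ζ v = 0)
    (hq : ∀ v, ¬ N.IsBoundary v → ∑ e with N.Incident e v, q e v * N.n e v = 0) :
    ∑ e, (q e (N.tgt e) * ζ (N.tgt e) - q e (N.src e) * ζ (N.src e)) = 0 := by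
  have h : ∑ v, ζ v * ∑ e with N.Incident e v, q e v * N.n e v = 0 := by
    refine Finset.sum_eq_zero fun v _ => ?_
    by_cases hv : N.IsBoundary v
    · rw [hζ v hv, zero_mul]
    · rw [hq v hv, mul_zero]
  rw [← h]
  simp only [Finset.sum_filter, Finset.mul_sum]
  rw [Finset.sum_comm]
  refine Finset.sum_congr rfl fun e _ => ?_
  rw [Finset.sum_eq_add (N.tgt e) (N.src e) (N.src_ne_tgt e).symm]
  · rw [if_pos (N.incident_tgt e), if_pos (N.incident_src e), n_src, n_tgt]
    ring
  · intro v _ hv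
    rw [if_neg, mul_zero]
    rintro (h' | h')
    · exact hv.2 h'.symm
    · exact hv.1 h'.symm
  · exact fun h' => (h' (Finset.mem_univ _)).elim
  · exact fun h' => (h' (Finset.mem_univ _)).elim

namespace Mesh

variable {T : N.Mesh}

theorem left_lt_right (e : E) (i : Fin (T.num e)) : T.left e i < T.right e i :=
  T.strictMono e i.castSucc_lt_succ

theorem pt_mem (e : E) (j : Fin (T.num e + 1)) : T.pt e j ∈ Icc 0 (N.len e) := by
  rw [← T.pt_zero e, ← T.pt_last e]
  exact ⟨(T.strictMono e).monotone (Fin.zero_le j), (T.strictMono e).monotone (Fin.le_last j)⟩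

theorem last_ne_zero (e : E) : Fin.last (T.num e) ≠ 0 := fun h => by
  have := T.pt_last e
  rw [h, T.pt_zero] at this
  exact (N.len_pos e).ne this

theorem node_zero (e : E) : T.node e 0 = Sum.inl (N.src e) := by simp [node]

theorem node_last (e : E) : T.node e (Fin.last (T.num e)) = Sum.inl (N.tgt e) := by
  unfold node
  rw [dif_neg (last_ne_zero e), dif_pos rfl]

theorem sum_succ_sub_castSucc {m : ℕ} (G : Fin (m + 1) → ℝ) :
    ∑ i : Fin m, (G i.succ - G i.castSucc) = G (Fin.last m) - G 0 := by
  have h1 := Fin.sum_univ_succ G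
  have h2 := Fin.sum_univ_castSucc G
  rw [Finset.sum_sub_distrib]
  linarith

open Classical in
-- Along an edge the sum telescopes to the end points, and the balance at the vertices does the
-- rest.
theorem elemSum_flux_eq_zero [Fintype V] [Fintype E] (Q : (e : E) → Fin (T.num e + 1) → ℝ)
    (q : E → V → ℝ) (h0 : ∀ e, Q e 0 = q e (N.src e))
    (h1 : ∀ e, Q e (Fin.last (T.num e)) = q e (N.tgt e))
    (hq : ∀ v, ¬ N.IsBoundary v → ∑ e with N.Incident e v, q e v * N.n e v = 0)
    {ζ : T.Node → ℝ} (hζ : ζ ∈ T.hybrid) :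
    T.elemSum (fun e i => Q e i.succ * ζ (T.node e i.succ)
      - Q e i.castSucc * ζ (T.node e i.castSucc)) = 0 := by
  unfold elemSum
  rw [← sum_flux_eq_zero (N := N) q (fun v => ζ (Sum.inl v)) hζ hq]
  refine Finset.sum_congr rfl fun e _ => ?_
  rw [sum_succ_sub_castSucc (fun j => Q e j * ζ (T.node e j)), node_zero, node_last, h0, h1]

theorem inData_right (g : {v // N.IsBoundary v} → ℝ) (e : E) (i : Fin (T.num e)) :
    T.inData g (T.node e i.succ) = 0 := by
  unfold node
  rw [dif_neg (Fin.succ_ne_zero i)]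
  split_ifs with h
  · simp only [inData, not_isInflow_tgt, dif_neg, not_false_eq_true]
  · rfl

/-- Among left end points of elements, only a source vertex can be a boundary vertex, and it is then
an inflow vertex. -/
theorem inData_left (g : {v // N.IsBoundary v} → ℝ) (e : E) (i : Fin (T.num e)) :
    T.inData g (T.node e i.castSucc) = T.bdData g (T.node e i.castSucc) := by
  unfold node
  split_ifs with h h'
  · by_cases hb : N.IsBoundary (N.src e)
    · simp only [inData, bdData, (isInflow_src_iff e).2 hb, hb, dif_pos]
    · simp only [inData, bdData, mt (isInflow_src_iff e).1 hb, hb, dif_neg, not_false_eq_true]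
  · exact absurd h' i.castSucc_lt_last.ne
  · rfl

theorem bdData_mul_eq_zero (g : {v // N.IsBoundary v} → ℝ) {ζ : T.Node → ℝ} (hζ : ζ ∈ T.hybrid)
    (x : T.Node) : T.bdData g x * ζ x = 0 := by
  rcases x with v | x
  · by_cases hv : N.IsBoundary v
    · rw [hζ v hv, mul_zero]
    · simp [bdData, hv]
  · simp [bdData]

theorem poly_eq {k : ℕ} (w : T.DG k) (e : E) (i : Fin (T.num e)) : poly w e i = polyOf (w e i) :=
  rfl

section Sums

variable [Fintype E]

theorem elemSum_add (F G : (e : E) → Fin (T.num e) → ℝ) :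
    T.elemSum (fun e i => F e i + G e i) = T.elemSum F + T.elemSum G := by
  simp only [elemSum, Finset.sum_add_distrib]

theorem elemSum_sub (F G : (e : E) → Fin (T.num e) → ℝ) :
    T.elemSum (fun e i => F e i - G e i) = T.elemSum F - T.elemSum G := by
  simp only [elemSum, Finset.sum_sub_distrib]

theorem elemSum_neg (F : (e : E) → Fin (T.num e) → ℝ) :
    T.elemSum (fun e i => - F e i) = - T.elemSum F := by
  simp only [elemSum, Finset.sum_neg_distrib]

theorem elemSum_mul (r : ℝ) (F : (e : E) → Fin (T.num e) → ℝ) :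
    T.elemSum (fun e i => r * F e i) = r * T.elemSum F := by
  simp only [elemSum, Finset.mul_sum]

theorem elemSum_congr {F G : (e : E) → Fin (T.num e) → ℝ} (h : ∀ e i, F e i = G e i) :
    T.elemSum F = T.elemSum G := by
  simp only [elemSum, h]

theorem elemSum_le {F G : (e : E) → Fin (T.num e) → ℝ} (h : ∀ e i, F e i ≤ G e i) :
    T.elemSum F ≤ T.elemSum G :=
  Finset.sum_le_sum fun e _ => Finset.sum_le_sum fun i _ => h e i

/-- The discrete problem as a sum over elements, with the boundary data included in the hybrid
variable. -/
theorem elemSum_elemForm_eq {k : ℕ} {b : E → ℝ} (hb : ∀ e, 0 < b e) (ε α : ℝ)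
    (g : {v // N.IsBoundary v} → ℝ) (ut u w : T.DG k) (uhat : T.Node → ℝ) {what : T.Node → ℝ}
    (hw : what ∈ T.hybrid) :
    T.elemSum (fun e i => elemForm (T.left e i) (T.right e i) (b e) ε α (polyOf (u e i))
      (polyOf (ut e i)) (uhat (T.node e i.castSucc) + T.bdData g (T.node e i.castSucc))
      (uhat (T.node e i.succ) + T.bdData g (T.node e i.succ)) (polyOf (w e i))
      (what (T.node e i.castSucc)) (what (T.node e i.succ))) =
    T.innerProd ut w + T.bForm b u uhat w what + ε * T.dForm α u uhat w what
      - T.lForm b ε α g w := by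
  unfold innerProd bForm dForm lForm bdSum
  simp only [← elemSum_add, ← elemSum_sub, ← elemSum_neg, ← elemSum_mul]
  refine elemSum_congr fun e i => ?_
  have hr := bdData_mul_eq_zero g hw (T.node e i.succ)
  have hl := bdData_mul_eq_zero g hw (T.node e i.castSucc)
  -- For positive velocity the upwind flux uses the interior value at the right end and the hybrid
  -- value at the left end.
  have m1 : max (1 * b e) 0 = b e := by rw [one_mul, max_eq_left (hb e).le]
  have m2 : min (1 * b e) 0 = 0 := by rw [one_mul, min_eq_right (hb e).le]
  have m3 : max (-1 * b e) 0 = 0 := max_eq_right (by linarith [hb e])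
  have m4 : min (-1 * b e) 0 = -1 * b e := min_eq_left (by linarith [hb e])
  simp only [Fintype.sum_bool, val, dval, hval, bd, normal, if_true, Bool.false_eq_true, if_false,
    inData_right, inData_left, m1, m2, m3, m4, poly_eq, mul_assoc,
    intervalIntegral.integral_const_mul, elemForm, size, left, right]
  -- Putting the data into the hybrid variable creates products of boundary data with `what` that
  -- `lForm` does not contain; they vanish because `what` is zero on the boundary.
  linear_combination (b e + ε * α / (T.pt e i.succ - T.pt e i.castSucc)) * hl
    + ε * α / (T.pt e i.succ - T.pt e i.castSucc) * hr

end Sums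

end Mesh

end Network

/-! ### Consistency and energy estimate at a fixed time -/

/-- After integration by parts the volume terms cancel by the differential equation and the traces
of `w` cancel too; only the total flux times the hybrid test values survives. -/
theorem elemExact_eq {a b l β ε : ℝ} (hab : a < b) (ha : 0 ≤ a) (hb : b ≤ l)
    {f : Sobolev 2 0 l ℝ} {y : ℕ → ℝ → ℝ} (hy : IsRep f y) {ut : L2 0 l ℝ}
    (h : ut + β • wd f 1 = ε • wd f 2) (w : ℝ[X]) (ωl ωr : ℝ) :
    elemExact a b β ε ut (y 0) (y 1) w ωl ωr =
      - ((β * y 0 b - ε * y 1 b) * ωr - (β * y 0 a - ε * y 1 a) * ωl) := by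
  have hl : 0 ≤ l := ha.trans (hab.le.trans hb)
  have ha' : a ∈ Icc 0 l := ⟨ha, hab.le.trans hb⟩
  have hb' : b ∈ Icc 0 l := ⟨ha.trans hab.le, hb⟩
  have p0 : IsPrimitive a b (y 0) (y 1) := (hy.isPrimitive 0 (by omega)).mono ha' hb'
  have p1 : IsPrimitive a b (y 1) (y 2) := (hy.isPrimitive 1 (by omega)).mono ha' hb'
  have e1 := p0.integral_mul_eq (IsPrimitive.poly w) hab.le
  have e2 := p1.integral_mul_eq (IsPrimitive.poly w) hab.le
  have hw : ContinuousOn (fun x => w.eval x) (uIcc a b) := w.continuous.continuousOn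
  have hae : ∀ᵐ x ∂(volume.restrict (Ioo 0 l)), ut x = ε * y 2 x - β * y 1 x := by
    have h' : (ut + β • wd f 1 : L2 0 l ℝ) =ᵐ[volume.restrict (Ioo 0 l)]
      (ε • wd f 2 : L2 0 l ℝ) := by rw [h]
    filter_upwards [h', Lp.coeFn_add ut (β • wd f 1), Lp.coeFn_smul β (wd f 1),
      Lp.coeFn_smul ε (wd f 2), hy.ae_eq 1, hy.ae_eq 2] with x h1 h2 h3 h4 h5 h6
    rw [h2, Pi.add_apply, h3, h4, Pi.smul_apply, Pi.smul_apply, smul_eq_mul, smul_eq_mul, h5,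
      h6] at h1
    have h7 : ut x + β * y 1 x = ε * y 2 x := h1
    linarith
  have e3 : ∫ x in a..b, ut x * w.eval x =
      ε * (∫ x in a..b, y 2 x * w.eval x) - β * ∫ x in a..b, y 1 x * w.eval x := by
    rw [← intervalIntegral.integral_const_mul, ← intervalIntegral.integral_const_mul,
      ← intervalIntegral.integral_sub ((p1.integrable.mul_continuousOn hw).const_mul _)
        ((p0.integrable.mul_continuousOn hw).const_mul _), ← integral_Ioo_eq hab.le,
      ← integral_Ioo_eq hab.le]
    refine integral_congr_ae ?_
    filter_upwards [ae_mono (Measure.restrict_mono (Ioo_subset_Ioo ha hb) le_rfl) hae] with x hx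
    rw [hx]
    ring
  unfold elemExact
  rw [e3, e1, e2]
  ring

namespace Network

variable {V E : Type*} [Fintype E] {N : Network V E}

open Classical in
/-- The values of the exact solution at the nodes, `y e` being the continuous representative on the
edge `e`. -/
def nodalValue (T : N.Mesh) (g : {v // N.IsBoundary v} → ℝ) (uhat : {v // ¬ N.IsBoundary v} → ℝ)
    (y : E → ℝ → ℝ) : T.Node → ℝ
  | Sum.inl v => if h : N.IsBoundary v then g ⟨v, h⟩ else uhat ⟨v, h⟩
  | Sum.inr p => y p.1 (T.pt p.1 p.2.1)

variable {b : E → ℝ} {ε α tmax : ℝ} {g : ℝ → {v // N.IsBoundary v} → ℝ}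
  {u : (e : E) → ℝ → Sobolev 2 0 (N.len e) ℝ} {uhat : ℝ → {v // ¬ N.IsBoundary v} → ℝ}
  {T : N.Mesh}

theorem IsSolution.nodalValue_node (hu : N.IsSolution b ε tmax g u uhat) {t : ℝ}
    (ht : t ∈ Ioo 0 tmax) {y : E → ℕ → ℝ → ℝ} (hy : ∀ e, IsRep (u e t) (y e)) (e : E)
    (j : Fin (T.num e + 1)) :
    nodalValue T (g t) (uhat t) (fun e => y e 0) (T.node e j) = y e 0 (T.pt e j) := by
  have hvert : ∀ v, N.Incident e v → nodalValue T (g t) (uhat t) (fun e => y e 0) (Sum.inl v) =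
      ptVal (wd (u e t) 0) (N.coord e v) := by
    intro v hv
    by_cases hb : N.IsBoundary v
    · simp only [nodalValue, hb, dif_pos, hu.boundary v hb e hv t ht]
    · simp only [nodalValue, hb, dif_neg, not_false_eq_true, hu.coupling v hb e hv t ht]
  have hpt : ∀ x ∈ Icc 0 (N.len e), ptVal (wd (u e t) 0) x = y e 0 x := fun x hx =>
    (hy e).ptVal_eq (N.len_pos e) (i := 0) (by simp) hx
  unfold Mesh.node
  split_ifs with h h'
  · rw [hvert _ (N.incident_src e), coord_src, hpt _ ⟨le_rfl, (N.len_pos e).le⟩, h, T.pt_zero]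
  · rw [hvert _ (N.incident_tgt e), coord_tgt, hpt _ ⟨(N.len_pos e).le, le_rfl⟩, h', T.pt_last]
  · rfl

/-- The total flux is single-valued at mesh points inside an edge and balanced at interior vertices,
so the remaining flux terms cancel. -/
theorem IsSolution.elemSum_elemExact [Fintype V] (hu : N.IsSolution b ε tmax g u uhat) {t : ℝ}
    (ht : t ∈ Ioo 0 tmax) {y : E → ℕ → ℝ → ℝ} (hy : ∀ e, IsRep (u e t) (y e))
    (w : (e : E) → Fin (T.num e) → ℝ[X]) {ζ : T.Node → ℝ} (hζ : ζ ∈ T.hybrid) :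
    T.elemSum (fun e i => elemExact (T.left e i) (T.right e i) (b e) ε
      (derivWithin (fun s => wd (u e s) 0) (Icc 0 tmax) t : L2 0 (N.len e) ℝ)
      (y e 0) (y e 1) (w e i)
      (ζ (T.node e i.castSucc)) (ζ (T.node e i.succ))) = 0 := by
  have h := Mesh.elemSum_flux_eq_zero (T := T)
    (fun e j => b e * y e 0 (T.pt e j) - ε * y e 1 (T.pt e j))
    (fun e v => b e * ptVal (wd (u e t) 0) (N.coord e v) - ε * ptVal (wd (u e t) 1) (N.coord e v))
    (fun e => by
      have h0 : (0 : ℝ) ∈ Icc 0 (N.len e) := ⟨le_rfl, (N.len_pos e).le⟩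
      simp only [coord_src]
      rw [T.pt_zero, (hy e).ptVal_eq (N.len_pos e) (i := 0) (by simp) h0,
        (hy e).ptVal_eq (N.len_pos e) (i := 1) (by simp) h0]
      rfl)
    (fun e => by
      have h0 : N.len e ∈ Icc 0 (N.len e) := ⟨(N.len_pos e).le, le_rfl⟩
      simp only [coord_tgt]
      rw [T.pt_last, (hy e).ptVal_eq (N.len_pos e) (i := 0) (by simp) h0,
        (hy e).ptVal_eq (N.len_pos e) (i := 1) (by simp) h0]
      rfl)
    (fun v hv => hu.conservation v hv t ht) hζ
  rw [← neg_eq_zero, ← Mesh.elemSum_neg] at h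
  refine Eq.trans ?_ h
  refine Mesh.elemSum_congr fun e i => ?_
  exact elemExact_eq (Mesh.left_lt_right e i) (Mesh.pt_mem e _).1 (Mesh.pt_mem e _).2 (hy e)
    (hu.equation e t ht) _ _ _

/-- The energy estimate for the discrete error at a fixed time. -/
theorem energy_step [Fintype V] {k : ℕ} (hk : 1 ≤ k) {bLow bUp τ : ℝ} (hbLow : 0 < bLow)
    (hα : 0 < α) (hε : 0 < ε) (hτ : 0 < τ) (hflow : N.IsFlow bLow bUp b)
    (hu : N.IsSolution b ε tmax g u uhat) {uh : ℝ → T.DG k} {uhhat : ℝ → T.Node → ℝ}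
    (hd : T.IsDiscreteSolution b ε α tmax g uh uhhat) {t : ℝ} (ht : t ∈ Ioo 0 tmax)
    (f f' : (e : E) → (i : Fin (T.num e)) → Sobolev (k + 1) (T.left e i) (T.right e i) ℝ)
    (hf : ∀ e i, wd (f e i) 0 =ᵐ[volume.restrict (Ioo (T.left e i) (T.right e i))] wd (u e t) 0)
    (hf' : ∀ e i, ∀ φ : ℝ → ℝ, Continuous φ →
      ∫ x in Ioo (T.left e i) (T.right e i),
        φ x * derivWithin (fun s => wd (u e s) 0) (Icc 0 tmax) t x =
      ∫ x in Ioo (T.left e i) (T.right e i), φ x * wd (f' e i) 0 x)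
    (c c' : T.DG k)
    (hc : ∀ e i v, IsRep (f e i) v → IsRadau (T.left e i) (T.right e i) (c e i) v)
    (hc' : ∀ e i v, IsRep (f' e i) v → IsRadau (T.left e i) (T.right e i) (c' e i) v) :
    T.elemSum (fun e i => ∫ x in (T.left e i)..(T.right e i),
      (polyOf (uh t e i - c e i)).eval x *
        (polyOf (derivWithin uh (Icc 0 tmax) t e i - c' e i)).eval x) ≤
    T.elemSum (fun e i => τ * (T.size e i ^ (2 * k + 2) * ‖f' e i‖ ^ 2)
      + 1 / (4 * τ) * (∫ x in (T.left e i)..(T.right e i),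
        (polyOf (uh t e i - c e i)).eval x * (polyOf (uh t e i - c e i)).eval x)
      + ε * ((1 + 1 / α + α) * (T.size e i ^ (2 * k) * ‖f e i‖ ^ 2))) := by
  have hbpos : ∀ e, 0 < b e := fun e => hbLow.trans_le (hflow.lower e)
  choose y hy using fun e => exists_isRep (N.len_pos e) (u e t)
  choose v hv using fun e i => exists_isRep (T.left_lt_right e i) (f e i)
  choose v' hv' using fun e i => exists_isRep (T.left_lt_right e i) (f' e i)
  have hsub : ∀ e i, EqOn (v e i 0) (y e 0) (Icc (T.left e i) (T.right e i)) ∧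
      EqOn (v e i 1) (y e 1) (Icc (T.left e i) (T.right e i)) := fun e i =>
    (hv e i).eqOn_sub (T.left_lt_right e i) (T.pt_mem e _).1 (T.pt_mem e _).2 (by omega) le_rfl
      (hy e) (hf e i)
  set Y := nodalValue T (g t) (uhat t) (fun e => y e 0) with hY
  have hYn : ∀ e j, Y (T.node e j) = y e 0 (T.pt e j) := hu.nodalValue_node ht hy
  -- Nodal error of the hybrid variable with boundary data included. It vanishes at boundary
  -- vertices, where both methods carry the same data, and is thus an admissible test function.
  set ζ : T.Node → ℝ := fun x => uhhat t x + T.bdData (g t) x - Y x with hζ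
  have hωh : ζ ∈ T.hybrid := by
    intro z hz
    have := hd.hybrid_mem t (Ioo_subset_Icc_self ht) z hz
    simp [hζ, hY, nodalValue, Mesh.bdData, hz, this]
  have hdisc := Mesh.elemSum_elemForm_eq hbpos ε α (g t) (derivWithin uh (Icc 0 tmax) t) (uh t)
    (uh t - c) (uhhat t) hωh
  rw [hd.equation t (Ioo_subset_Icc_self ht) _ _ hωh, sub_self] at hdisc
  have hex := hu.elemSum_elemExact ht hy (fun e i => polyOf (uh t e i - c e i)) hωh
  -- Conservation of the flow, with ζ² as nodal weight, removes the convective differences.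
  have hflux := Mesh.elemSum_flux_eq_zero (T := T) (fun e _ => b e) (fun e _ => b e)
    (fun _ => rfl) (fun _ => rfl) hflow.conservation
    (ζ := fun x => ζ x ^ 2) (fun z hz => by simp [hωh z hz])
  have hloc : ∀ e i,
      (∫ x in (T.left e i)..(T.right e i), (polyOf (uh t e i - c e i)).eval x *
        (polyOf (derivWithin uh (Icc 0 tmax) t e i - c' e i)).eval x)
      - (τ * (T.size e i ^ (2 * k + 2) * ‖f' e i‖ ^ 2)
        + 1 / (4 * τ) * (∫ x in (T.left e i)..(T.right e i),
          (polyOf (uh t e i - c e i)).eval x * (polyOf (uh t e i - c e i)).eval x)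
        + ε * ((1 + 1 / α + α) * (T.size e i ^ (2 * k) * ‖f e i‖ ^ 2)))
      - 1 / 2 * (b e * ζ (T.node e i.succ) ^ 2 - b e * ζ (T.node e i.castSucc) ^ 2) ≤
      elemForm (T.left e i) (T.right e i) (b e) ε α (polyOf (uh t e i))
        (polyOf (derivWithin uh (Icc 0 tmax) t e i))
        (uhhat t (T.node e i.castSucc) + T.bdData (g t) (T.node e i.castSucc))
        (uhhat t (T.node e i.succ) + T.bdData (g t) (T.node e i.succ))
        (polyOf ((uh t - c) e i)) (ζ (T.node e i.castSucc)) (ζ (T.node e i.succ))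
      - elemExact (T.left e i) (T.right e i) (b e) ε
        (derivWithin (fun s => wd (u e s) 0) (Icc 0 tmax) t : L2 0 (N.len e) ℝ)
      (y e 0) (y e 1)
        (polyOf (uh t e i - c e i)) (ζ (T.node e i.castSucc)) (ζ (T.node e i.succ)) := by
    intro e i
    have hlr := T.left_lt_right e i
    have ha : T.left e i ∈ Icc (T.left e i) (T.right e i) := ⟨le_rfl, hlr.le⟩
    have hb : T.right e i ∈ Icc (T.left e i) (T.right e i) := ⟨hlr.le, le_rfl⟩
    have hωl : ζ (T.node e i.castSucc) = uhhat t (T.node e i.castSucc)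
        + T.bdData (g t) (T.node e i.castSucc) - v e i 0 (T.left e i) := by
      rw [(hsub e i).1 ha]
      simp only [hζ, hYn]
      rfl
    have hωr : ζ (T.node e i.succ) = uhhat t (T.node e i.succ)
        + T.bdData (g t) (T.node e i.succ) - v e i 0 (T.right e i) := by
      rw [(hsub e i).1 hb]
      simp only [hζ, hYn]
      rfl
    have key := elemForm_sub_elemExact_ge hk hlr (hv e i) (hc e i _ (hv e i)) (hv' e i)
      (hc' e i _ (hv' e i)) hα (hbpos e).le hε.le hτ (uh t e i)
      (derivWithin uh (Icc 0 tmax) t e i)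
      (uhhat t (T.node e i.castSucc) + T.bdData (g t) (T.node e i.castSucc))
      (uhhat t (T.node e i.succ) + T.bdData (g t) (T.node e i.succ))
    rw [← hωl, ← hωr] at key
    -- The local estimate uses representatives of the H^{k+1} function on the element; they are
    -- exchanged for those of the solution on the whole edge, the time derivative only under the
    -- integral against a polynomial.
    have hexact : elemExact (T.left e i) (T.right e i) (b e) ε (v' e i 0) (v e i 0) (v e i 1)
        (polyOf (uh t e i - c e i)) (ζ (T.node e i.castSucc)) (ζ (T.node e i.succ)) =
        elemExact (T.left e i) (T.right e i) (b e) ε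
        (derivWithin (fun s => wd (u e s) 0) (Icc 0 tmax) t : L2 0 (N.len e) ℝ)
      (y e 0) (y e 1)
        (polyOf (uh t e i - c e i)) (ζ (T.node e i.castSucc)) (ζ (T.node e i.succ)) := by
      set p := polyOf (uh t e i - c e i) with hp
      have i0 : ∫ x in (T.left e i)..(T.right e i), v' e i 0 x * p.eval x =
          ∫ x in (T.left e i)..(T.right e i),
            derivWithin (fun s => wd (u e s) 0) (Icc 0 tmax) t x * p.eval x := by
        have h1 := hf' e i (fun x => p.eval x) p.continuous
        rw [← integral_Ioo_eq hlr.le, ← integral_Ioo_eq hlr.le]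
        simp only [mul_comm _ (p.eval _)]
        rw [h1]
        refine integral_congr_ae ?_
        filter_upwards [(hv' e i).ae_eq 0] with x hx
        rw [hx]
        rfl
      have i1 : ∫ x in (T.left e i)..(T.right e i), v e i 0 x * p.derivative.eval x =
          ∫ x in (T.left e i)..(T.right e i), y e 0 x * p.derivative.eval x := by
        refine intervalIntegral.integral_congr fun x hx => ?_
        rw [uIcc_of_le hlr.le] at hx
        simp only [(hsub e i).1 hx]
      have i2 : ∫ x in (T.left e i)..(T.right e i), v e i 1 x * p.derivative.eval x =
          ∫ x in (T.left e i)..(T.right e i), y e 1 x * p.derivative.eval x := by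
        refine intervalIntegral.integral_congr fun x hx => ?_
        rw [uIcc_of_le hlr.le] at hx
        simp only [(hsub e i).2 hx]
      unfold elemExact
      rw [i0, i1, i2, (hsub e i).1 ha, (hsub e i).1 hb, (hsub e i).2 ha, (hsub e i).2 hb]
    rw [hexact] at key
    refine le_trans (le_of_eq ?_) key
    simp only [Mesh.size]
    ring
  have hsum := Mesh.elemSum_le hloc
  simp only [Mesh.elemSum_sub (T := T), Mesh.elemSum_mul (T := T)] at hsum
  simp only [Mesh.elemSum_sub (T := T)] at hflux
  rw [hdisc, hex, hflux] at hsum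
  linarith

end Network

/-! ### Integration of the energy estimate in time -/

theorem IsPrimitive.finset_sum {ι : Type*} (s : Finset ι) {a b : ℝ} {f f' : ι → ℝ → ℝ}
    (h : ∀ i ∈ s, IsPrimitive a b (f i) (f' i)) :
    IsPrimitive a b (fun x => ∑ i ∈ s, f i x) (fun x => ∑ i ∈ s, f' i x) := by
  refine ⟨?_, fun x hx => ?_⟩
  · have := IntervalIntegrable.sum s fun i hi => (h i hi).integrable
    simpa only [← Finset.sum_apply] using! this
  have ha : a ∈ Icc a b := ⟨le_rfl, hx.1.trans hx.2⟩
  rw [intervalIntegral.integral_finsetSum fun i hi => (h i hi).intervalIntegrable_sub ha hx,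
    ← Finset.sum_add_distrib]
  exact Finset.sum_congr rfl fun i hi => (h i hi).eq_add_integral x hx

theorem IsPrimitive.const_mul {a b : ℝ} {f f' : ℝ → ℝ} (h : IsPrimitive a b f f') (r : ℝ) :
    IsPrimitive a b (fun x => r * f x) (fun x => r * f' x) := by
  refine ⟨h.integrable.const_mul r, fun x hx => ?_⟩
  rw [intervalIntegral.integral_const_mul, ← mul_add, ← h.eq_add_integral x hx]

/-- Mass matrix form: the time dependence sits in the coefficients alone, so the energy can be
differentiated in time as a finite sum. -/
theorem integral_polyOf_mul {k : ℕ} (c d : Fin (k + 1) → ℝ) (a b : ℝ) :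
    ∫ x in a..b, (polyOf c).eval x * (polyOf d).eval x =
      ∑ i : Fin (k + 1), ∑ j : Fin (k + 1), (∫ x in a..b, x ^ ((i : ℕ) + j)) * (c i * d j) := by
  simp only [eval_polyOf, Finset.sum_mul_sum]
  rw [intervalIntegral.integral_finsetSum]
  · refine Finset.sum_congr rfl fun i _ => ?_
    rw [intervalIntegral.integral_finsetSum]
    · refine Finset.sum_congr rfl fun j _ => ?_
      rw [← intervalIntegral.integral_mul_const]
      refine intervalIntegral.integral_congr fun x _ => ?_
      simp only [pow_add]
      ring
    · intro j _
      exact Continuous.intervalIntegrable (by fun_prop) _ _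
  · intro i _
    exact Continuous.intervalIntegrable (by fun_prop) _ _

theorem isPrimitive_integral_sq {k : ℕ} {s : ℝ} (hs : 0 ≤ s) {θ φ : ℝ → Fin (k + 1) → ℝ}
    (h : IsPrimitive 0 s θ φ) (a b : ℝ) :
    IsPrimitive 0 s (fun t => ∫ x in a..b, (polyOf (θ t)).eval x * (polyOf (θ t)).eval x)
      (fun t => 2 * ∫ x in a..b, (polyOf (θ t)).eval x * (polyOf (φ t)).eval x) := by
  have hc : ∀ i, IsPrimitive 0 s (fun t => θ t i) (fun t => φ t i) := fun i =>
    h.clm (ContinuousLinearMap.proj (R := ℝ) (φ := fun _ : Fin (k + 1) => ℝ) i)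
  have hsum := IsPrimitive.finset_sum Finset.univ fun i (_ : i ∈ Finset.univ) =>
    IsPrimitive.finset_sum Finset.univ fun j (_ : j ∈ Finset.univ) =>
      ((hc i).mul (hc j) hs).const_mul (∫ x in a..b, x ^ ((i : ℕ) + j))
  have e1 : (fun t => ∫ x in a..b, (polyOf (θ t)).eval x * (polyOf (θ t)).eval x) =
      fun t => ∑ i : Fin (k + 1), ∑ j : Fin (k + 1),
        (∫ x in a..b, x ^ ((i : ℕ) + j)) * (θ t i * θ t j) :=
    funext fun t => integral_polyOf_mul _ _ _ _
  have e2 : (fun t => 2 * ∫ x in a..b, (polyOf (θ t)).eval x * (polyOf (φ t)).eval x) =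
      fun t => ∑ i : Fin (k + 1), ∑ j : Fin (k + 1),
        (∫ x in a..b, x ^ ((i : ℕ) + j)) * (φ t i * θ t j + θ t i * φ t j) := by
    funext t
    rw [integral_polyOf_mul]
    simp only [mul_add, Finset.sum_add_distrib]
    rw [two_mul]
    congr 1
    rw [Finset.sum_comm]
    refine Finset.sum_congr rfl fun i _ => Finset.sum_congr rfl fun j _ => ?_
    rw [add_comm (j : ℕ), mul_comm (θ t j)]
  rw [e1, e2]
  exact hsum

/-- Integrate up to a maximum point of `F` and replace `F t` by its maximum. With the factor 1/(2s)
on an interval of length at most `s`, this costs at most half the maximum, which is absorbed on the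
left. -/
theorem le_of_isPrimitive_of_ae_le {s A : ℝ} (hs : 0 < s) {F F' B : ℝ → ℝ}
    (hF : IsPrimitive 0 s F F') (hF0 : F 0 = 0) (hB : IntervalIntegrable B volume 0 s)
    (hB0 : ∀ t, 0 ≤ B t) (hBA : ∫ t in (0 : ℝ)..s, B t ≤ A)
    (h : ∀ᵐ t ∂(volume.restrict (Ioo 0 s)), F' t ≤ B t + 1 / (2 * s) * F t) :
    ∀ t ∈ Icc 0 s, F t ≤ 2 * A := by
  have hFc := hF.continuousOn hs.le
  obtain ⟨r, hr, hmax⟩ := isCompact_Icc.exists_isMaxOn ⟨0, ⟨le_rfl, hs.le⟩⟩ hFc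
  have hmax' : ∀ t ∈ Icc 0 s, F t ≤ F r := fun t ht => hmax ht
  have hr0 : 0 ≤ F r := hF0 ▸ hmax' 0 ⟨le_rfl, hs.le⟩
  have hB1 : IntervalIntegrable B volume 0 r := hB.mono_set (by
    rw [uIcc_of_le hr.1, uIcc_of_le hs.le]
    exact Icc_subset_Icc_right hr.2)
  have h1 : F r ≤ ∫ t in (0 : ℝ)..r, (B t + 1 / (2 * s) * F r) := by
    have e1 : F r = ∫ t in (0 : ℝ)..r, F' t := by
      have := hF.eq_add_integral r hr
      rwa [hF0, zero_add] at this
    refine e1.le.trans ?_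
    refine intervalIntegral.integral_mono_ae_restrict hr.1
      (hF.intervalIntegrable_sub ⟨le_rfl, hs.le⟩ hr) (hB1.add intervalIntegrable_const) ?_
    rw [← restrict_Ioo_eq_restrict_Icc]
    filter_upwards [ae_mono (Measure.restrict_mono (Ioo_subset_Ioo_right hr.2) le_rfl) h,
      ae_restrict_mem measurableSet_Ioo] with t h1 ht
    refine h1.trans ?_
    have := hmax' t ⟨ht.1.le, ht.2.le.trans hr.2⟩
    gcongr
  rw [intervalIntegral.integral_add hB1 intervalIntegrable_const, intervalIntegral.integral_const,
    smul_eq_mul, sub_zero] at h1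
  have h2 : ∫ t in (0 : ℝ)..r, B t ≤ ∫ t in (0 : ℝ)..s, B t :=
    intervalIntegral.integral_mono_interval le_rfl hr.1 hr.2
      (Filter.Eventually.of_forall hB0) hB
  have h3 : r * (1 / (2 * s) * F r) ≤ F r / 2 := by
    have : r * (1 / (2 * s) * F r) ≤ s * (1 / (2 * s) * F r) := by
      gcongr
      exact hr.2
    refine this.trans_eq ?_
    field_simp
  intro t ht
  linarith [hmax' t ht]

section Time

variable {tmax : ℝ} {X : Type*} [NormedAddCommGroup X]

theorem intervalIntegrable_norm_sq (htm : 0 < tmax) (f : L2 0 tmax X) :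
    IntervalIntegrable (fun t => ‖f t‖ ^ 2) volume 0 tmax :=
  (intervalIntegrable_iff_integrableOn_Ioo_of_le htm.le).2 (L2.integrableOn_norm_sq f)

variable [NormedSpace ℝ X] [CompleteSpace X]

theorem integral_norm_sq_wd_le (htm : 0 < tmax) (U : Sobolev 1 0 tmax X) (i : Fin 2) :
    ∫ t in (0 : ℝ)..tmax, ‖wd U i t‖ ^ 2 ≤ ‖U‖ ^ 2 := by
  rw [← integral_Ioo_eq htm.le (fun t => ‖wd U i t‖ ^ 2), ← L2.norm_sq_eq]
  exact pow_le_pow_left₀ (norm_nonneg _) (Sobolev.norm_wd_le U i) 2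

theorem intervalIntegrable_norm_timePrim_sq (htm : 0 < tmax) (U : Sobolev 1 0 tmax X) :
    IntervalIntegrable (fun t => ‖timePrim U t‖ ^ 2) volume 0 tmax := by
  refine ContinuousOn.intervalIntegrable ?_
  rw [uIcc_of_le htm.le]
  exact ((timePrim_isPrimitive U htm).continuousOn htm.le).norm.pow 2

theorem integral_norm_timePrim_sq_le (htm : 0 < tmax) (U : Sobolev 1 0 tmax X)
    (h : ∀ᵐ t ∂(volume.restrict (Ioo 0 tmax)), wd U 0 t = timePrim U t) :
    ∫ t in (0 : ℝ)..tmax, ‖timePrim U t‖ ^ 2 ≤ ‖U‖ ^ 2 := by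
  refine le_trans (le_of_eq ?_) (integral_norm_sq_wd_le htm U 0)
  rw [← integral_Ioo_eq htm.le, ← integral_Ioo_eq htm.le]
  refine integral_congr_ae ?_
  filter_upwards [h] with t ht
  rw [ht]

end Time

/-- The error on an element in terms of the discrete error. -/
theorem lintegral_error_le {k : ℕ} {a b l : ℝ} (hab : a < b) {f : Sobolev (k + 1) a b ℝ}
    {g : L2 0 l ℝ} (h : wd f 0 =ᵐ[volume.restrict (Ioo a b)] g) {c : Fin (k + 1) → ℝ}
    (hc : ∀ v, IsRep f v → IsRadau a b c v) (p : Fin (k + 1) → ℝ) :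
    ∫⁻ x in Ioo a b, ‖g x - (polyOf p).eval x‖ₑ ^ 2 ≤
      ENNReal.ofReal (2 * ((b - a) ^ (2 * k + 2) * ‖f‖ ^ 2) +
        2 * ∫ x in a..b, (polyOf (p - c)).eval x * (polyOf (p - c)).eval x) := by
  obtain ⟨v, hv⟩ := exists_isRep hab f
  have hr := hc v hv
  set M := (b - a) ^ (2 * k + 1) * ‖f‖ ^ 2 with hM
  have hM0 : 0 ≤ M := by
    have : 0 ≤ b - a := by linarith
    positivity
  have hi : IntervalIntegrable (fun x => (polyOf (p - c)).eval x * (polyOf (p - c)).eval x)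
      volume a b :=
    ((polyOf (p - c)).continuous.mul (polyOf (p - c)).continuous).intervalIntegrable _ _
  have hle : ∫⁻ x in Ioo a b, ‖g x - (polyOf p).eval x‖ₑ ^ 2 ≤ ∫⁻ x in Ioo a b,
      ENNReal.ofReal (2 * M + 2 * ((polyOf (p - c)).eval x * (polyOf (p - c)).eval x)) := by
    refine lintegral_mono_ae ?_
    filter_upwards [h, hv.ae_eq 0, ae_restrict_mem measurableSet_Ioo] with x h1 h2 hx
    rw [← ofReal_norm, ← ENNReal.ofReal_pow (norm_nonneg _)]
    refine ENNReal.ofReal_le_ofReal ?_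
    have h3 : g x = v 0 x := h1.symm.trans h2
    have h4 := hr.sq_le hab hv (Ioo_subset_Icc_self hx)
    rw [h3, Real.norm_eq_abs, sq_abs, polyOf_sub, Polynomial.eval_sub]
    nlinarith [sq_nonneg (v 0 x - (polyOf c).eval x
      + ((polyOf p).eval x - (polyOf c).eval x))]
  refine hle.trans (le_of_eq ?_)
  have hint : IntervalIntegrable
      (fun x => 2 * M + 2 * ((polyOf (p - c)).eval x * (polyOf (p - c)).eval x)) volume a b :=
    intervalIntegrable_const.add (hi.const_mul 2)
  rw [← ofReal_integral_eq_lintegral_ofReal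
    ((intervalIntegrable_iff_integrableOn_Ioo_of_le hab.le).1 hint)
    (Filter.Eventually.of_forall fun x => by
      have := mul_self_nonneg ((polyOf (p - c)).eval x)
      simp only [Pi.zero_apply]
      linarith), integral_Ioo_eq hab.le,
    intervalIntegral.integral_add intervalIntegrable_const (hi.const_mul 2),
    intervalIntegral.integral_const, intervalIntegral.integral_const_mul, smul_eq_mul, hM]
  congr 2
  ring

/-! ### Discrete error at all times -/

namespace Network

variable {V E : Type*} [Fintype E] {N : Network V E} {b : E → ℝ} {ε α tmax : ℝ}
  {g : ℝ → {v // N.IsBoundary v} → ℝ} {u : (e : E) → ℝ → Sobolev 2 0 (N.len e) ℝ}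
  {uhat : ℝ → {v // ¬ N.IsBoundary v} → ℝ} {T : N.Mesh}

theorem Mesh.isPrimitive_elemSum {s : ℝ} {f f' : (e : E) → Fin (T.num e) → ℝ → ℝ}
    (h : ∀ e i, IsPrimitive 0 s (f e i) (f' e i)) :
    IsPrimitive 0 s (fun t => T.elemSum fun e i => f e i t)
      (fun t => T.elemSum fun e i => f' e i t) :=
  IsPrimitive.finset_sum _ fun e _ => IsPrimitive.finset_sum _ fun i _ => h e i

theorem Mesh.intervalIntegrable_elemSum {s : ℝ} {f : (e : E) → Fin (T.num e) → ℝ → ℝ}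
    (h : ∀ e i, IntervalIntegrable (f e i) volume 0 s) :
    IntervalIntegrable (fun t => T.elemSum fun e i => f e i t) volume 0 s :=
  (Mesh.isPrimitive_elemSum (f := fun e i t => ∫ r in (0 : ℝ)..t, f e i r) fun e i =>
    ⟨h e i, fun _ _ => by simp⟩).integrable

theorem Mesh.integral_elemSum {s : ℝ} {f : (e : E) → Fin (T.num e) → ℝ → ℝ}
    (h : ∀ e i, IntervalIntegrable (f e i) volume 0 s) :
    ∫ t in (0 : ℝ)..s, (T.elemSum fun e i => f e i t) =
      T.elemSum fun e i => ∫ t in (0 : ℝ)..s, f e i t := by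
  unfold elemSum
  rw [intervalIntegral.integral_finsetSum]
  · exact Finset.sum_congr rfl fun e _ =>
      intervalIntegral.integral_finsetSum fun i _ => h e i
  · intro e _
    have := IntervalIntegrable.sum Finset.univ fun i (_ : i ∈ Finset.univ) => h e i
    simpa only [← Finset.sum_apply] using! this

set_option maxHeartbeats 1000000 in
theorem elemSum_discrete_error_le [Fintype V] {k : ℕ} (hk : 1 ≤ k) {bLow bUp : ℝ}
    (hbLow : 0 < bLow) (hα : 0 < α) (hε : 0 < ε) (htm : 0 < tmax)
    (hflow : N.IsFlow bLow bUp b) (hu : N.IsSolution b ε tmax g u uhat) {uh : ℝ → T.DG k}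
    {uhhat : ℝ → T.Node → ℝ} (hd : T.IsDiscreteSolution b ε α tmax g uh uhhat)
    (U : (e : E) → (i : Fin (T.num e)) →
      Sobolev 1 0 tmax (Sobolev (k + 1) (T.left e i) (T.right e i) ℝ))
    (hU : ∀ e i, Represents (U e i) (fun s x => wd (u e s) 0 x))
    (G : (e : E) → (i : Fin (T.num e)) →
      Sobolev (k + 1) (T.left e i) (T.right e i) ℝ →L[ℝ] (Fin (k + 1) → ℝ))
    (hG : ∀ e i f v, IsRep f v → IsRadau (T.left e i) (T.right e i) (G e i f) v)
    {t : ℝ} (ht : t ∈ Icc 0 tmax) :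
    T.elemSum (fun e i => ∫ x in (T.left e i)..(T.right e i),
      (polyOf (uh t e i - G e i (timePrim (U e i) t))).eval x *
        (polyOf (uh t e i - G e i (timePrim (U e i) t))).eval x) ≤
    2 * T.elemSum (fun e i => 2 * tmax * T.size e i ^ (2 * k + 2) * ‖U e i‖ ^ 2
      + 2 * ε * (1 + 1 / α + α) * T.size e i ^ (2 * k) * ‖U e i‖ ^ 2) := by
  have hmem : ∀ e (j : Fin (T.num e + 1)), T.pt e j ∈ Icc 0 (N.len e) := fun e j => T.pt_mem e j
  have hcont : ∀ e, ContinuousOn (fun s => wd (u e s) 0) (Icc 0 tmax) := fun e =>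
    (hu.contDiff e).continuousOn
  have hu0 : ∀ e, wd (u e 0) 0 = 0 := fun e => by
    rw [hu.initial e]
    rfl
  have hspec := fun e (i : Fin (T.num e)) => timePrim_spec (U := U e i)
    (u := fun s => wd (u e s) 0) htm (hmem e _).1 (hmem e _).2 (hcont e) (hu0 e) (hU e i)
  have hder := fun e (i : Fin (T.num e)) => ae_integral_timeDeriv (U := U e i)
    (u := fun s => wd (u e s) 0) htm (hmem e _).1 (hmem e _).2 (hu.contDiff e) (hspec e i).1
  -- The bounded linear projection commutes with the Bochner integral, so the time derivative of θ
  -- involves the projection of the time derivative of u.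
  have hθ : ∀ e i, IsPrimitive 0 tmax (fun t => uh t e i - G e i (timePrim (U e i) t))
      (fun t => derivWithin uh (Icc 0 tmax) t e i - G e i (wd (U e i) 1 t)) := fun e i => by
    have h1 := (isPrimitive_derivWithin htm hd.contDiff).clm
      ((ContinuousLinearMap.proj (R := ℝ) (φ := fun _ : Fin (T.num e) => Fin (k + 1) → ℝ) i).comp
      (ContinuousLinearMap.proj (R := ℝ)
        (φ := fun e : E => Fin (T.num e) → Fin (k + 1) → ℝ) e))
    exact h1.sub ((timePrim_isPrimitive (U e i) htm).clm (G e i))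
  have hF := Mesh.isPrimitive_elemSum (T := T) fun e i =>
    isPrimitive_integral_sq htm.le (hθ e i) (T.left e i) (T.right e i)
  have hsize : ∀ e i, 0 ≤ T.size e i := fun e i => (sub_pos.2 (T.left_lt_right e i)).le
  set K := 1 + 1 / α + α with hK
  have hK0 : 0 ≤ K := by positivity
  have hBi : ∀ e i, IntervalIntegrable (fun t =>
      2 * tmax * T.size e i ^ (2 * k + 2) * ‖wd (U e i) 1 t‖ ^ 2
        + 2 * ε * K * T.size e i ^ (2 * k) * ‖timePrim (U e i) t‖ ^ 2) volume 0 tmax := fun e i =>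
    ((intervalIntegrable_norm_sq htm (wd (U e i) 1)).const_mul _).add
      ((intervalIntegrable_norm_timePrim_sq htm (U e i)).const_mul _)
  refine le_of_isPrimitive_of_ae_le htm hF ?_ (Mesh.intervalIntegrable_elemSum hBi) ?_ ?_ ?_ t ht
  · refine Finset.sum_eq_zero fun e _ => Finset.sum_eq_zero fun i _ => ?_
    have h0 : timePrim (U e i) 0 = 0 := intervalIntegral.integral_same
    simp only [hd.initial, h0, map_zero, Pi.zero_apply, sub_zero]
    simp [polyOf]
  · intro t
    refine Finset.sum_nonneg fun e _ => Finset.sum_nonneg fun i _ => ?_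
    have := hsize e i
    positivity
  · rw [Mesh.integral_elemSum hBi]
    refine Mesh.elemSum_le fun e i => ?_
    have := hsize e i
    rw [intervalIntegral.integral_add
      ((intervalIntegrable_norm_sq htm (wd (U e i) 1)).const_mul _)
      ((intervalIntegrable_norm_timePrim_sq htm (U e i)).const_mul _),
      intervalIntegral.integral_const_mul, intervalIntegral.integral_const_mul]
    refine add_le_add ?_ ?_
    · exact mul_le_mul_of_nonneg_left (integral_norm_sq_wd_le htm (U e i) 1) (by positivity)
    · exact mul_le_mul_of_nonneg_left
        (integral_norm_timePrim_sq_le htm (U e i) (hspec e i).2) (by positivity)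
  · have hder' : ∀ᵐ t ∂(volume.restrict (Ioo 0 tmax)), ∀ e, ∀ i : Fin (T.num e), ∀ φ : ℝ → ℝ,
        Continuous φ → ∫ x in Ioo (T.left e i) (T.right e i),
          φ x * derivWithin (fun s => wd (u e s) 0) (Icc 0 tmax) t x =
        ∫ x in Ioo (T.left e i) (T.right e i), φ x * wd (wd (U e i) 1 t) 0 x := by
      rw [ae_all_iff]
      intro e
      rw [ae_all_iff]
      exact fun i => hder e i
    filter_upwards [hder', ae_restrict_mem measurableSet_Ioo] with t h1 ht
    -- Young's parameter is `tmax` here. After doubling, the term in ‖θ‖² has the factor 1/(2 tmax)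
    -- needed for the absorption at the maximum.
    have key := energy_step hk hbLow hα hε htm hflow hu hd ht
      (fun e i => timePrim (U e i) t) (fun e i => wd (U e i) 1 t)
      (fun e i => (hspec e i).1 t (Ioo_subset_Icc_self ht)) h1
      (fun e i => G e i (timePrim (U e i) t)) (fun e i => G e i (wd (U e i) 1 t))
      (fun e i v hv => hG e i _ v hv) (fun e i v hv => hG e i _ v hv)
    have key2 := mul_le_mul_of_nonneg_left key (zero_le_two (α := ℝ))
    rw [← Mesh.elemSum_mul, ← Mesh.elemSum_mul] at key2
    rw [← Mesh.elemSum_mul, ← Mesh.elemSum_add]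
    refine key2.trans_eq (Mesh.elemSum_congr fun e i => ?_)
    have hquot : 2 * (1 / (4 * tmax)) = 1 / (2 * tmax) := by
      field_simp
      norm_num
    rw [← hquot, hK]
    ring

end Network

end HybridDG

end

/-! ### The error estimate -/

theorem lemma2 (k : ℕ) (hk : 1 ≤ k) (α tmax bLow bUp : ℝ) (hα : 0 < α) (htmax : 0 < tmax)
    (hb : 0 < bLow) :
    ∃ C : ℝ, 0 < C ∧
      ∀ (V E : Type*) [Fintype V] [Fintype E] (N : HybridDG.Network V E) (b : E → ℝ) (m : ℕ)
        (g : ℝ → {v // N.IsBoundary v} → ℝ) (ε : ℝ)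
        (u : (e : E) → ℝ → HybridDG.Sobolev 2 0 (N.len e) ℝ)
        (uhat : ℝ → {v // ¬ N.IsBoundary v} → ℝ)
        (T : N.Mesh) (uh : ℝ → T.DG k) (uhhat : ℝ → T.Node → ℝ),
        N.IsFlow bLow bUp b → N.IsBoundaryData tmax m g → 0 < ε → ε ≤ 1 →
        N.IsSolution b ε tmax g u uhat →
        T.IsDiscreteSolution b ε α tmax g uh uhhat →
        ∀ t ∈ Set.Ioo 0 tmax,
          T.errorSq (fun e => HybridDG.wd (u e t) 0) (uh t) ≤
            ENNReal.ofReal C * T.elemSum fun e i =>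
              ENNReal.ofReal (ε * T.size e i ^ (2 * k) + T.size e i ^ (2 * k + 2)) *
                HybridDG.bochnerNormSq tmax (k + 1) (T.left e i) (T.right e i)
                  (fun s x => HybridDG.wd (u e s) 0 x) := by
  -- Projection error: 2 tmax. Discrete error: the factor 2 from squaring a sum and the factor 2
  -- from the absorption turn 2 tmax and 2(1 + 1/α + α) into 8 tmax and 8(1 + 1/α + α).
  have hC : 0 < 10 * tmax + 8 * (1 + 1 / α + α) := by positivity
  refine ⟨10 * tmax + 8 * (1 + 1 / α + α), hC, ?_⟩
  intro V E _ _ N b m g ε u uhat T uh uhhat hflow _ hε _ hu hd t ht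
  have hsize : ∀ e i, 0 < T.size e i := fun e i => sub_pos.2 (T.left_lt_right e i)
  have hw : ∀ e i, 0 < ε * T.size e i ^ (2 * k) + T.size e i ^ (2 * k + 2) := fun e i => by
    have := hsize e i
    positivity
  by_cases hfin : ∀ e, ∀ i : Fin (T.num e),
      ∃ U : HybridDG.Sobolev 1 0 tmax (HybridDG.Sobolev (k + 1) (T.left e i) (T.right e i) ℝ),
        HybridDG.Represents U (fun s x => HybridDG.wd (u e s) 0 x)
  · have hB : ∀ e i, HybridDG.bochnerNormSq tmax (k + 1) (T.left e i) (T.right e i)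
        (fun s x => HybridDG.wd (u e s) 0 x) = ENNReal.ofReal (‖(hfin e i).choose‖ ^ 2) :=
      fun e i => dif_pos (hfin e i)
    have hU := fun e i => (hfin e i).choose_spec
    set U := fun e i => (hfin e i).choose with hUdef
    choose G hG using fun e i => HybridDG.exists_radau k (T.left_lt_right e i)
    have htI := Ioo_subset_Icc_self ht
    have hspec := fun e (i : Fin (T.num e)) => HybridDG.timePrim_spec (U := U e i)
      (u := fun s => HybridDG.wd (u e s) 0) htmax (T.pt_mem e _).1 (T.pt_mem e _).2
      (hu.contDiff e).continuousOn (by rw [hu.initial e]; rfl) (hU e i)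
    have hdisc := HybridDG.Network.elemSum_discrete_error_le hk hb hα hε htmax hflow hu hd U hU G hG
      htI
    have hloc := fun e i => HybridDG.lintegral_error_le (T.left_lt_right e i) ((hspec e i).1 t htI)
      (hG e i _) (uh t e i)
    have hpos : ∀ e i, 0 ≤ 2 * (T.size e i ^ (2 * k + 2) * ‖HybridDG.timePrim (U e i) t‖ ^ 2) +
        2 * ∫ x in (T.left e i)..(T.right e i),
          (HybridDG.polyOf (uh t e i - G e i (HybridDG.timePrim (U e i) t))).eval x *
          (HybridDG.polyOf (uh t e i - G e i (HybridDG.timePrim (U e i) t))).eval x := by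
      intro e i
      have h1 := intervalIntegral.integral_nonneg (μ := volume) (T.left_lt_right e i).le
        (f := fun x => (HybridDG.polyOf (uh t e i - G e i (HybridDG.timePrim (U e i) t))).eval x *
          (HybridDG.polyOf (uh t e i - G e i (HybridDG.timePrim (U e i) t))).eval x)
        (fun x _ => mul_self_nonneg _)
      have := hsize e i
      positivity
    simp only [hB]
    have hrhs : ENNReal.ofReal (10 * tmax + 8 * (1 + 1 / α + α)) * T.elemSum (fun e i =>
        ENNReal.ofReal (ε * T.size e i ^ (2 * k) + T.size e i ^ (2 * k + 2)) *
          ENNReal.ofReal (‖U e i‖ ^ 2)) =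
        ENNReal.ofReal ((10 * tmax + 8 * (1 + 1 / α + α)) * T.elemSum (fun e i =>
          (ε * T.size e i ^ (2 * k) + T.size e i ^ (2 * k + 2)) * ‖U e i‖ ^ 2)) := by
      rw [ENNReal.ofReal_mul hC.le]
      congr 1
      unfold HybridDG.Network.Mesh.elemSum
      rw [ENNReal.ofReal_sum_of_nonneg fun e _ => Finset.sum_nonneg fun i _ =>
        mul_nonneg (hw e i).le (sq_nonneg _)]
      refine Finset.sum_congr rfl fun e _ => ?_
      rw [ENNReal.ofReal_sum_of_nonneg fun i _ => mul_nonneg (hw e i).le (sq_nonneg _)]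
      exact Finset.sum_congr rfl fun i _ => (ENNReal.ofReal_mul (hw e i).le).symm
    rw [hrhs]
    have hlhs : T.errorSq (fun e => HybridDG.wd (u e t) 0) (uh t) ≤
        ENNReal.ofReal (T.elemSum fun e i =>
          2 * (T.size e i ^ (2 * k + 2) * ‖HybridDG.timePrim (U e i) t‖ ^ 2) +
          2 * ∫ x in (T.left e i)..(T.right e i),
          (HybridDG.polyOf (uh t e i - G e i (HybridDG.timePrim (U e i) t))).eval x *
          (HybridDG.polyOf (uh t e i - G e i (HybridDG.timePrim (U e i) t))).eval x) := by
      unfold HybridDG.Network.Mesh.errorSq HybridDG.Network.Mesh.elemSum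
      rw [ENNReal.ofReal_sum_of_nonneg fun e _ => Finset.sum_nonneg fun i _ => hpos e i]
      refine Finset.sum_le_sum fun e _ => ?_
      rw [ENNReal.ofReal_sum_of_nonneg fun i _ => hpos e i]
      exact Finset.sum_le_sum fun i _ => hloc e i
    refine hlhs.trans (ENNReal.ofReal_le_ofReal ?_)
    rw [HybridDG.Network.Mesh.elemSum_add, HybridDG.Network.Mesh.elemSum_mul,
      HybridDG.Network.Mesh.elemSum_mul]
    have hV : T.elemSum (fun e i => T.size e i ^ (2 * k + 2) *
        ‖HybridDG.timePrim (U e i) t‖ ^ 2) ≤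
        T.elemSum (fun e i => T.size e i ^ (2 * k + 2) * (tmax * ‖U e i‖ ^ 2)) := by
      refine HybridDG.Network.Mesh.elemSum_le fun e i => ?_
      have := hsize e i
      exact mul_le_mul_of_nonneg_left (HybridDG.norm_timePrim_sq_le (U e i) htmax htI)
        (by positivity)
    refine (add_le_add (mul_le_mul_of_nonneg_left hV zero_le_two)
      (mul_le_mul_of_nonneg_left hdisc zero_le_two)).trans ?_
    simp only [← HybridDG.Network.Mesh.elemSum_mul, ← HybridDG.Network.Mesh.elemSum_add]
    refine HybridDG.Network.Mesh.elemSum_le fun e i => ?_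
    have hs := hsize e i
    have p1 : 0 ≤ (1 + 1 / α + α) * T.size e i ^ (2 * k + 2) * ‖U e i‖ ^ 2 := by positivity
    have p2 : 0 ≤ tmax * ε * T.size e i ^ (2 * k) * ‖U e i‖ ^ 2 := by positivity
    linarith
  -- If regularity fails on one element, its positive weight times ∞ makes the right-hand side
  -- infinite.
  · push Not at hfin
    obtain ⟨e, i, hei⟩ := hfin
    have htop : HybridDG.bochnerNormSq tmax (k + 1) (T.left e i) (T.right e i)
        (fun s x => HybridDG.wd (u e s) 0 x) = ⊤ := dif_neg (by push Not; exact hei)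
    have hsum : (T.elemSum fun e i =>
        ENNReal.ofReal (ε * T.size e i ^ (2 * k) + T.size e i ^ (2 * k + 2)) *
          HybridDG.bochnerNormSq tmax (k + 1) (T.left e i) (T.right e i)
            (fun s x => HybridDG.wd (u e s) 0 x)) = ⊤ := by
      unfold HybridDG.Network.Mesh.elemSum
      refine ENNReal.sum_eq_top.2 ⟨e, Finset.mem_univ _, ENNReal.sum_eq_top.2
        ⟨i, Finset.mem_univ _, ?_⟩⟩
      simp only [htop, ENNReal.mul_top (ENNReal.ofReal_pos.2 (hw e i)).ne']
    rw [hsum, ENNReal.mul_top (ENNReal.ofReal_pos.2 hC).ne']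
    exact le_top
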